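/- Let $n\ge 2$, $k\in\{1,\dots,n-1\}$ and $0<\alpha\le 1$. Write $\mathcal H^k$ for the $k$-dimensional Hausdorff measure on $\mathbb R^n$ (normalized with $\sum_i \mathrm{diam}(E_i)^k$), $B(x,r)$ for the closed ball, $P_V$ for the orthogonal projection onto a linear subspace $V$, $d(V,W)=\|P_V-P_W\|$ (operator norm), and $$Q_\alpha(x,V,\lambda)=\{y\in\mathbb R^n:\ |P_{V^\perp}(y-x)|\le\lambda|P_V(y-x)|^{1+\alpha}\}.$$ Let $r_0,\lambda,\delta,M>0$ and $\varepsilon<\frac{1}{4^k+1}\delta$. Let $F'\subseteq F\subseteq\mathbb R^n$ be such that for every $x\in F$ $$\mathcal H^k(F\cap B(x,r))\le M r^k\qquad\text{for all }0<r\le r_0,$$ and such that for every $x\in F'$ $$\mathcal H^k(F\cap B(x,r))\ge\delta r^k\qquad\text{for all }0<r\le r_0$$ and there is a $k$-dimensional linear subspace $V_x$ of $\mathbb R^n$ with $$\mathcal H^k\big(F\cap B(x,r)\setminus Q_\alpha(x,V_x,\lambda)\big)\le\varepsilon r^k\qquad\text{for all }0<r\le r_0 .$$ Put $$C=\frac{20^{n+1}\,2n\,M\lambda}{\delta\,\omega_n},\qquad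 r_1=\big(4\lambda(2+4^{1+\alpha})+8C\big)^{-1/\alpha},$$ where $\omega_n$ is the Lebesgue measure of the unit ball of $\mathbb R^n$, and suppose that $\mathrm{diam}(F')\le r_1$ and $\mathrm{diam}(F')\le r_0/5$. Then 1. $d(V_x,V_y)\le C|x-y|^\alpha$ for all $x,y\in F'$; 2. $F'$ is covered by a single $k$-dimensional $C^{1,\alpha}$ graph: there are a $k$-dimensional linear subspace $W\subset\mathbb R^n$ and a $C^1$ map $f:W\to W^\perp$ whose differential is $\alpha$-Hölder continuous on $W$, such that $F'\subseteq\{v+f(v): v\in W\}$. -/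

import Mathlib

noncomputable section

/-- The `α`-paraboloid `Q_α(x, V, lam) = {y : |P_{V^⊥}(y - x)| ≤ lam * |P_V (y - x)| ^ (1 + α)}`,
where `P_V` is the orthogonal projection onto the linear subspace `V` of `ℝⁿ`. -/
def paraboloid {n : ℕ} (α : ℝ) (x : EuclideanSpace ℝ (Fin n))
    (V : Submodule ℝ (EuclideanSpace ℝ (Fin n))) (lam : ℝ) :
    Set (EuclideanSpace ℝ (Fin n)) :=
  {y | ‖Vᗮ.starProjection (y - x)‖ ≤ lam * ‖V.starProjection (y - x)‖ ^ (1 + α)}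

/-- The distance `d(V, W) = ‖P_V - P_W‖` (operator norm) between linear subspaces of `ℝⁿ`. -/
def planeDist {n : ℕ} (V W : Submodule ℝ (EuclideanSpace ℝ (Fin n))) : ℝ :=
  ‖V.starProjection - W.starProjection‖

/-- `f` is a `C^{1,α}` map: it is continuously differentiable and its differential is
(globally) `α`-Hölder continuous. -/
def IsC1Alpha {X Y : Type*} [NormedAddCommGroup X] [NormedSpace ℝ X]
    [NormedAddCommGroup Y] [NormedSpace ℝ Y] (α : ℝ) (f : X → Y) : Prop :=
  ContDiff ℝ 1 f ∧ ∃ K : ℝ, ∀ u v : X, ‖fderiv ℝ f u - fderiv ℝ f v‖ ≤ K * ‖u - v‖ ^ α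

/-- `Γ ⊆ ℝⁿ` is a `k`-dimensional `C^{1,α}` graph: it is the graph `{v + f v : v ∈ W}` of a
`C^{1,α}` map `f : W → W^⊥` over some `k`-dimensional linear subspace `W`. -/
def IsC1AlphaGraph {n : ℕ} (k : ℕ) (α : ℝ) (Γ : Set (EuclideanSpace ℝ (Fin n))) : Prop :=
  ∃ W : Submodule ℝ (EuclideanSpace ℝ (Fin n)), Module.finrank ℝ W = k ∧
    ∃ f : W → Wᗮ, IsC1Alpha α f ∧
      Γ = Set.range fun v : W =>
        (v : EuclideanSpace ℝ (Fin n)) + (f v : EuclideanSpace ℝ (Fin n))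

/-- The Lebesgue measure `ω_n` of the unit ball of `ℝⁿ`. -/
def unitBallVolume (n : ℕ) : ℝ :=
  (MeasureTheory.volume (Metric.closedBall (0 : EuclideanSpace ℝ (Fin n)) 1)).toReal

/-- The Hölder constant `C(n, δ, M, lam) = 20^(n+1) * 2n * M * lam / (δ * ω_n)`. -/
def tiltConst (n : ℕ) (δ M lam : ℝ) : ℝ :=
  20 ^ (n + 1) * (2 * n) * M * lam / (δ * unitBallVolume n)

/-- The scale `r₁ = (4 * lam * (2 + 4^(1+α)) + 8 * C)^(-1/α)`, with `C = C(n, δ, M, lam)`. -/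
def graphScale (n : ℕ) (α δ M lam : ℝ) : ℝ :=
  (4 * lam * (2 + (4 : ℝ) ^ (1 + α)) + 8 * tiltConst n δ M lam) ^ (-1 / α)

end

/-! Tilt. Let `r = ‖x - y‖` with `x`, `y` distinct points of `F'`. Since `ε` is small against `δ`, a
fixed fraction of the mass of `F ∩ B(x, r)` lies in both paraboloids
(`le_measure_inter_paraboloid`), hence within a multiple of `lam * r ^ (1 + α)` of both affine
planes. If one plane were tilted against the other by more than `C / 2 * r ^ α`, points near both
would lie near a common `(k - 1)`-plane (`exists_hyperplane_near`), within a width `t` comparable to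
`lam * r / C`. Covering by `t`-balls and the upper density bound leave too little mass there
(`measure_le_of_near_subspace`); `C` is chosen to make this a contradiction.

Graph. A point shared by both paraboloids, together with the tilt bound, shows that `y - x` leaves
`V x` only to order `1 + α`. Over one fixed plane `W = V x₀` the points of `F'` and the slopes of
their planes therefore form a `C^{1,α}` jet, and Whitney extension (`exists_isC1Alpha_extension`)
supplies `f`.

The extension avoids Whitney cubes: for scalar jets it is a supremum of paraconvex functions, which
has second differences of order `‖h‖ ^ (1 + α)`, and that bound with local boundedness already
forces `C^{1,α}` (`isC1Alpha_of_second_difference`). -/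

noncomputable section

open Filter Topology

/-! ### Second differences of order `1 + α` imply `C^{1,α}`. -/

section SecondDifference

variable {E G : Type*} [NormedAddCommGroup E] [NormedSpace ℝ E]
  [NormedAddCommGroup G] [NormedSpace ℝ G]

/-- The dyadic difference quotient `2ⁿ (F (x + 2⁻ⁿ h) - F x)`. -/
def dyadicQuotient (F : E → G) (x h : E) (n : ℕ) : G :=
  (2 : ℝ) ^ n • (F (x + ((2 : ℝ) ^ n)⁻¹ • h) - F x)

theorem two_pow_mul_norm_smul_rpow (α : ℝ) (n : ℕ) (h : E) :
    (2 : ℝ) ^ n * ‖((2 : ℝ) ^ n)⁻¹ • h‖ ^ (1 + α) = ((2 : ℝ) ^ (-α)) ^ n * ‖h‖ ^ (1 + α) := by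
  have h2 : (0 : ℝ) < 2 ^ n := by positivity
  rw [norm_smul, norm_inv, Real.norm_of_nonneg h2.le,
    Real.mul_rpow (by positivity) (norm_nonneg _), ← mul_assoc]
  congr 1
  rw [Real.inv_rpow h2.le, Real.rpow_add h2, Real.rpow_one, Real.rpow_neg (by norm_num), inv_pow,
    ← Real.rpow_natCast 2 n, ← Real.rpow_mul (by norm_num), ← Real.rpow_natCast (2 ^ α) n,
    ← Real.rpow_mul (by norm_num), mul_comm α]
  field_simp

/-- The points `x + 2⁻ⁿ h` and `x + 2⁻ⁿ k` are symmetric about `x + 2⁻⁽ⁿ⁺¹⁾ (h + k)`, so the left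
side is `2ⁿ` times a second difference there. The case `k = 0` makes the quotients Cauchy; general
`k` makes their limit additive. -/
theorem norm_dyadicQuotient_add_sub_le {F : E → G} {K α : ℝ} (hα : 0 < α) (hK : 0 ≤ K)
    (hF : ∀ x h, ‖F (x + h) + F (x - h) - (2 : ℝ) • F x‖ ≤ K * ‖h‖ ^ (1 + α))
    (x h k : E) (n : ℕ) :
    ‖dyadicQuotient F x h n + dyadicQuotient F x k n - dyadicQuotient F x (h + k) (n + 1)‖
      ≤ K * ‖h - k‖ ^ (1 + α) * ((2 : ℝ) ^ (-α)) ^ n := by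
  have h2 : (0 : ℝ) < 2 ^ n := by positivity
  set c : E := x + ((2 : ℝ) ^ (n + 1))⁻¹ • (h + k) with hc
  set d : E := ((2 : ℝ) ^ n)⁻¹ • ((1 / 2 : ℝ) • (h - k)) with hd
  have e1 : c + d = x + ((2 : ℝ) ^ n)⁻¹ • h := by
    rw [hc, hd, pow_succ, mul_inv]; module
  have e2 : c - d = x + ((2 : ℝ) ^ n)⁻¹ • k := by
    rw [hc, hd, pow_succ, mul_inv]; module
  have e3 : dyadicQuotient F x h n + dyadicQuotient F x k n
      - dyadicQuotient F x (h + k) (n + 1)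
      = (2 : ℝ) ^ n • (F (c + d) + F (c - d) - (2 : ℝ) • F c) := by
    rw [e1, e2, hc]; simp only [dyadicQuotient]; rw [pow_succ]; module
  rw [e3, norm_smul, Real.norm_of_nonneg h2.le]
  have h4 : ‖(1 / 2 : ℝ) • (h - k)‖ ≤ ‖h - k‖ := by
    rw [norm_smul]; norm_num; linarith [norm_nonneg (h - k)]
  calc (2 : ℝ) ^ n * ‖F (c + d) + F (c - d) - (2 : ℝ) • F c‖
      ≤ (2 : ℝ) ^ n * (K * ‖d‖ ^ (1 + α)) := by gcongr; exact hF c d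
    _ = K * (((2 : ℝ) ^ (-α)) ^ n * ‖(1 / 2 : ℝ) • (h - k)‖ ^ (1 + α)) := by
      rw [← two_pow_mul_norm_smul_rpow, ← hd]; ring
    _ ≤ K * (((2 : ℝ) ^ (-α)) ^ n * ‖h - k‖ ^ (1 + α)) := by gcongr
    _ = _ := by ring

theorem two_rpow_neg_lt_one {α : ℝ} (hα : 0 < α) : (2 : ℝ) ^ (-α) < 1 :=
  Real.rpow_lt_one_of_one_lt_of_neg (by norm_num) (by linarith)

theorem dyadicQuotient_zero_right (F : E → G) (x : E) (n : ℕ) : dyadicQuotient F x 0 n = 0 := by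
  simp [dyadicQuotient]

theorem dist_dyadicQuotient_succ_le {F : E → G} {K α : ℝ} (hα : 0 < α) (hK : 0 ≤ K)
    (hF : ∀ x h, ‖F (x + h) + F (x - h) - (2 : ℝ) • F x‖ ≤ K * ‖h‖ ^ (1 + α))
    (x h : E) (n : ℕ) :
    dist (dyadicQuotient F x h n) (dyadicQuotient F x h (n + 1))
      ≤ K * ‖h‖ ^ (1 + α) * ((2 : ℝ) ^ (-α)) ^ n := by
  have := norm_dyadicQuotient_add_sub_le hα hK hF x h 0 n
  rwa [dyadicQuotient_zero_right, add_zero, add_zero, sub_zero, ← dist_eq_norm] at this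

/-- A locally bounded function whose second differences are `O(‖h‖ ^ (1 + α))` has a first order
Taylor expansion with remainder `O(‖h‖ ^ (1 + α))` at every point. -/
theorem exists_taylor_of_second_difference [CompleteSpace G] {F : E → G} {K α : ℝ} (hα : 0 < α)
    (hK : 0 ≤ K)
    (hF : ∀ x h, ‖F (x + h) + F (x - h) - (2 : ℝ) • F x‖ ≤ K * ‖h‖ ^ (1 + α))
    (hbd : ∀ x, ∃ B, ∀ h, ‖h‖ ≤ 1 → ‖F (x + h)‖ ≤ B) (x : E) :
    ∃ L : E →L[ℝ] G, ∀ h,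
      ‖F (x + h) - F x - L h‖ ≤ K / (1 - (2 : ℝ) ^ (-α)) * ‖h‖ ^ (1 + α) := by
  have hρ := two_rpow_neg_lt_one hα
  have hρ0 : (0 : ℝ) ≤ (2 : ℝ) ^ (-α) := by positivity
  have hlim : ∀ h, ∃ l, Tendsto (dyadicQuotient F x h) atTop (𝓝 l) := fun h =>
    cauchySeq_tendsto_of_complete
      (cauchySeq_of_le_geometric _ _ hρ (dist_dyadicQuotient_succ_le hα hK hF x h))
  choose L hL using hlim
  have hT : ∀ h, ‖F (x + h) - F x - L h‖ ≤ K / (1 - (2 : ℝ) ^ (-α)) * ‖h‖ ^ (1 + α) := by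
    intro h
    have := dist_le_of_le_geometric_of_tendsto₀ _ _ hρ
      (dist_dyadicQuotient_succ_le hα hK hF x h) (hL h)
    rw [dist_eq_norm] at this
    simpa [dyadicQuotient, mul_div_right_comm] using this
  have hadd : ∀ h k, L (h + k) = L h + L k := by
    intro h k
    have h1 : Tendsto (fun n => dyadicQuotient F x h n + dyadicQuotient F x k n
        - dyadicQuotient F x (h + k) (n + 1)) atTop (𝓝 (L h + L k - L (h + k))) :=
      ((hL h).add (hL k)).sub ((hL (h + k)).comp (tendsto_add_atTop_nat 1))
    have h2 : Tendsto (fun n => dyadicQuotient F x h n + dyadicQuotient F x k n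
        - dyadicQuotient F x (h + k) (n + 1)) atTop (𝓝 0) := by
      refine squeeze_zero_norm (norm_dyadicQuotient_add_sub_le hα hK hF x h k) ?_
      simpa using (tendsto_pow_atTop_nhds_zero_of_lt_one hρ0 hρ).const_mul
        (K * ‖h - k‖ ^ (1 + α))
    exact (sub_eq_zero.1 (tendsto_nhds_unique h1 h2)).symm
  let A : E →+ G := AddMonoidHom.mk' L hadd
  obtain ⟨B, hB⟩ := hbd x
  have hC : 0 ≤ K / (1 - (2 : ℝ) ^ (-α)) := div_nonneg hK (by linarith)
  have hLB : ∀ h, ‖h‖ ≤ 1 → ‖A h‖ ≤ B + B + K / (1 - (2 : ℝ) ^ (-α)) := by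
    intro h hh
    have e : A h = F (x + h) - F x - (F (x + h) - F x - L h) := by
      simp [A]
    have hx : ‖F x‖ ≤ B := by simpa using hB 0 (by simp)
    have h3 : ‖h‖ ^ (1 + α) ≤ 1 := Real.rpow_le_one (norm_nonneg _) hh (by linarith)
    rw [e]
    calc _ ≤ ‖F (x + h)‖ + ‖F x‖ + ‖F (x + h) - F x - L h‖ :=
          (norm_sub_le _ _).trans (by gcongr; exact norm_sub_le _ _)
      _ ≤ B + B + K / (1 - (2 : ℝ) ^ (-α)) := by
          gcongr
          · exact hB h hh
          · exact (hT h).trans (mul_le_of_le_one_right hC h3)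
  set B' := B + B + K / (1 - (2 : ℝ) ^ (-α)) with hB'
  -- An additive map bounded on the unit ball is continuous at `0`, because `A (N • h) = N • A h`;
  -- real homogeneity then follows from additivity and continuity.
  have hcont : Continuous A := by
    apply continuous_of_continuousAt_zero
    rw [Metric.continuousAt_iff]
    intro ε hε
    obtain ⟨N, hN⟩ := exists_nat_gt (B' / ε)
    have hB0 : 0 ≤ B' := (norm_nonneg _).trans (hLB 0 (by simp))
    have hN0 : (0 : ℝ) < N := lt_of_le_of_lt (by positivity) hN
    refine ⟨1 / N, by positivity, fun {h} hh => ?_⟩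
    rw [dist_zero_right] at hh
    rw [map_zero, dist_zero_right]
    have h4 : ‖A (N • h)‖ ≤ B' := by
      apply hLB
      rw [← Nat.cast_smul_eq_nsmul ℝ, norm_smul, Real.norm_of_nonneg hN0.le]
      rw [lt_div_iff₀ hN0] at hh
      linarith
    rw [map_nsmul, ← Nat.cast_smul_eq_nsmul ℝ, norm_smul, Real.norm_of_nonneg hN0.le] at h4
    rw [div_lt_iff₀ hε] at hN
    by_contra! hcon
    nlinarith
  exact ⟨A.toRealLinearMap hcont, hT⟩

/-- A locally bounded function whose second differences are `O(‖h‖ ^ (1 + α))` is `C^{1,α}`. -/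
theorem isC1Alpha_of_second_difference [CompleteSpace G] {F : E → G} {K α : ℝ} (hα : 0 < α)
    (hK : 0 ≤ K)
    (hF : ∀ x h, ‖F (x + h) + F (x - h) - (2 : ℝ) • F x‖ ≤ K * ‖h‖ ^ (1 + α))
    (hbd : ∀ x, ∃ B, ∀ h, ‖h‖ ≤ 1 → ‖F (x + h)‖ ≤ B) : IsC1Alpha α F := by
  choose L hL using exists_taylor_of_second_difference hα hK hF hbd
  set C := K / (1 - (2 : ℝ) ^ (-α)) with hCdef
  have hC : 0 ≤ C := div_nonneg hK (by linarith [two_rpow_neg_lt_one hα])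
  have hderiv : ∀ x, HasFDerivAt F (L x) x := by
    intro x
    rw [hasFDerivAt_iff_isLittleO_nhds_zero]
    have h1 : (fun h => F (x + h) - F x - L x h) =O[𝓝 0] fun h : E => ‖h‖ ^ α * ‖h‖ := by
      refine Asymptotics.IsBigO.of_bound C (Eventually.of_forall fun h => (hL x h).trans_eq ?_)
      rw [Real.norm_of_nonneg (by positivity), Real.rpow_add_of_nonneg (norm_nonneg _) zero_le_one
        hα.le, Real.rpow_one, mul_comm (‖h‖)]
    refine h1.trans_isLittleO ?_
    have h2 : Tendsto (fun h : E => ‖h‖ ^ α) (𝓝 0) (𝓝 0) := by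
      have : Continuous fun h : E => ‖h‖ ^ α := continuous_norm.rpow_const fun _ => Or.inr hα.le
      simpa [Real.zero_rpow hα.ne'] using this.tendsto 0
    have h3 : (fun h : E => ‖h‖ ^ α * ‖h‖) =o[𝓝 0] fun h : E => 1 * ‖h‖ :=
      ((Asymptotics.isLittleO_one_iff ℝ).2 h2).mul_isBigO (Asymptotics.isBigO_refl _ _)
    simp only [one_mul] at h3
    exact h3.of_norm_right
  have hfd : ∀ x, fderiv ℝ F x = L x := fun x => (hderiv x).fderiv
  have hhol : ∀ u v : E, ‖fderiv ℝ F u - fderiv ℝ F v‖ ≤ 6 * C * 2 ^ α * ‖u - v‖ ^ α := by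
    intro u v
    rw [hfd, hfd]
    rcases eq_or_ne u v with rfl | huv
    · simp [Real.zero_rpow hα.ne']
    set k := v - u with hk
    have hkn : ‖u - v‖ = ‖k‖ := by rw [hk, norm_sub_rev]
    have hk0 : 0 < ‖k‖ := by rw [hk, norm_pos_iff, sub_ne_zero]; exact huv.symm
    -- Three Taylor expansions on the triangle `u`, `v`, `v + h` are compared. Taking `‖h‖ = ‖k‖`
    -- keeps every increment below `2 * ‖k‖`; homogeneity recovers all other vectors.
    have key : ∀ h : E, ‖h‖ = ‖k‖ →
        ‖L u h - L v h‖ ≤ 6 * C * 2 ^ α * ‖k‖ ^ α * ‖h‖ := by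
      intro h hh
      have e : L u h - L v h = (F (v + h) - F v - L v h) - (F (u + (k + h)) - F u - L u (k + h))
          + (F (u + k) - F u - L u k) := by
        have a1 : u + (k + h) = v + h := by rw [hk]; abel
        have a2 : u + k = v := by rw [hk]; abel
        rw [a1, a2, map_add]; abel
      have hkh : ‖k + h‖ ≤ 2 * ‖k‖ := (norm_add_le _ _).trans (by linarith)
      have p1 : ‖k‖ ^ (1 + α) ≤ (2 * ‖k‖) ^ (1 + α) := by gcongr; linarith
      have p2 : ‖k + h‖ ^ (1 + α) ≤ (2 * ‖k‖) ^ (1 + α) := by gcongr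
      have p3 : (2 * ‖k‖) ^ (1 + α) = 2 * 2 ^ α * ‖k‖ ^ α * ‖k‖ := by
        rw [Real.mul_rpow (by norm_num) (norm_nonneg _), Real.rpow_add (by norm_num),
          Real.rpow_add hk0, Real.rpow_one, Real.rpow_one]; ring
      rw [e]
      calc _ ≤ C * ‖h‖ ^ (1 + α) + C * ‖k + h‖ ^ (1 + α) + C * ‖k‖ ^ (1 + α) :=
            (norm_add_le _ _).trans (add_le_add ((norm_sub_le _ _).trans
              (add_le_add (hL v h) (hL u (k + h)))) (hL u k))
        _ ≤ C * (2 * ‖k‖) ^ (1 + α) + C * (2 * ‖k‖) ^ (1 + α) + C * (2 * ‖k‖) ^ (1 + α) := by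
            rw [hh]; gcongr
        _ = _ := by rw [p3, hh]; ring
    rw [hkn]
    refine ContinuousLinearMap.opNorm_le_bound _ (by positivity) fun w => ?_
    rcases eq_or_ne w 0 with rfl | hw
    · simp
    have hw0 : 0 < ‖w‖ := norm_pos_iff.2 hw
    have hn : ‖(‖k‖ / ‖w‖) • w‖ = ‖k‖ := by
      rw [norm_smul, Real.norm_of_nonneg (by positivity)]; field_simp
    have := key _ hn
    rw [hn, map_smul, map_smul, ← smul_sub, norm_smul, Real.norm_of_nonneg (by positivity),
      div_mul_eq_mul_div, div_le_iff₀ hw0] at this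
    rw [sub_apply]
    have h5 : ‖k‖ * ‖L u w - L v w‖ ≤ ‖k‖ * (6 * C * 2 ^ α * ‖k‖ ^ α * ‖w‖) := by linarith
    exact le_of_mul_le_mul_left h5 hk0
  refine ⟨contDiff_one_iff_fderiv.2 ⟨fun x => (hderiv x).differentiableAt, ?_⟩, _, hhol⟩
  rw [continuous_iff_continuousAt]
  intro x
  rw [ContinuousAt, tendsto_iff_norm_sub_tendsto_zero]
  refine squeeze_zero (fun _ => norm_nonneg _) (fun y => hhol y x) ?_
  have : Continuous fun y : E => 6 * C * 2 ^ α * ‖y - x‖ ^ α :=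
    continuous_const.mul ((continuous_id.sub continuous_const).norm.rpow_const
      fun _ => Or.inr hα.le)
  simpa [Real.zero_rpow hα.ne'] using this.tendsto x

end SecondDifference

end

/-! ### Whitney extension of `C^{1,α}` jets. -/

noncomputable section

section JetExtension

variable {E : Type*} [NormedAddCommGroup E] [InnerProductSpace ℝ E]

/-- The parallelogram law combined with concavity and subadditivity of `s ↦ s ^ ((1 + α) / 2)`. It
controls the second differences of the paraboloids of a jet. -/
theorem norm_rpow_add_add_norm_rpow_sub_le {α : ℝ} (hα0 : 0 < α) (hα1 : α ≤ 1) (x h : E) :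
    ‖x + h‖ ^ (1 + α) + ‖x - h‖ ^ (1 + α) ≤ 2 * ‖x‖ ^ (1 + α) + 2 * ‖h‖ ^ (1 + α) := by
  have hsq : ∀ v : E, ‖v‖ ^ (1 + α) = (‖v‖ ^ 2) ^ ((1 + α) / 2) := by
    intro v
    rw [← Real.rpow_natCast, ← Real.rpow_mul (norm_nonneg _)]
    congr 1; push_cast; ring
  have hp0 : 0 ≤ (1 + α) / 2 := by linarith
  have hp1 : (1 + α) / 2 ≤ 1 := by linarith
  rw [hsq, hsq, hsq, hsq]
  have hconc := (Real.concaveOn_rpow hp0 hp1).2 (Set.mem_Ici.2 (sq_nonneg ‖x + h‖))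
    (Set.mem_Ici.2 (sq_nonneg ‖x - h‖)) (by norm_num : (0 : ℝ) ≤ 1 / 2)
    (by norm_num : (0 : ℝ) ≤ 1 / 2) (by norm_num)
  have hpar := parallelogram_law_with_norm ℝ x h
  have e : (1 / 2 : ℝ) • ‖x + h‖ ^ 2 + (1 / 2 : ℝ) • ‖x - h‖ ^ 2 = ‖x‖ ^ 2 + ‖h‖ ^ 2 := by
    simp only [smul_eq_mul]; linarith
  rw [e] at hconc
  have hsub := Real.rpow_add_le_add_rpow (sq_nonneg ‖x‖) (sq_nonneg ‖h‖) hp0 hp1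
  simp only [smul_eq_mul] at hconc
  linarith

/-- The compatibility condition on a `1`-jet bounds the lower paraboloid at one point by the upper
paraboloid at another one. -/
theorem jet_lower_le_upper {α K : ℝ} (hα0 : 0 < α) (hα1 : α ≤ 1) (hK : 0 ≤ K)
    {y z x : E} {fy fz : ℝ} {Gy Gz : E →L[ℝ] ℝ}
    (hf : |fz - fy - Gy (z - y)| ≤ K * ‖z - y‖ ^ (1 + α))
    (hG : ‖Gz - Gy‖ ≤ K * ‖z - y‖ ^ α) :
    fy + Gy (x - y) - 6 * K * ‖x - y‖ ^ (1 + α)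
      ≤ fz + Gz (x - z) + 6 * K * ‖x - z‖ ^ (1 + α) := by
  -- The factor `6` is `4 + 2`: the value condition costs `4 * K * m ^ (1 + α)` and the slope
  -- condition `2 * K * m ^ (1 + α)`.
  set m := max ‖x - y‖ ‖x - z‖ with hm
  have hm0 : 0 ≤ m := (norm_nonneg _).trans (le_max_left _ _)
  have hzy : ‖z - y‖ ≤ 2 * m := by
    have : z - y = (x - y) - (x - z) := by abel
    rw [this]
    have h1 : ‖x - y‖ ≤ m := le_max_left _ _
    have h2 : ‖x - z‖ ≤ m := le_max_right _ _
    exact (norm_sub_le _ _).trans (by linarith)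
  have h2a : (2 : ℝ) ^ α ≤ 2 := by
    simpa using Real.rpow_le_rpow_of_exponent_le (by norm_num : (1 : ℝ) ≤ 2) hα1
  have h2b : (2 : ℝ) ^ (1 + α) ≤ 4 := by
    rw [Real.rpow_add (by norm_num), Real.rpow_one]; linarith
  have hmp : m ^ (1 + α) = m ^ α * m := by
    rw [Real.rpow_add_of_nonneg hm0 zero_le_one hα0.le, Real.rpow_one, mul_comm]
  have hsum : m ^ (1 + α) ≤ ‖x - y‖ ^ (1 + α) + ‖x - z‖ ^ (1 + α) := by
    rcases max_choice ‖x - y‖ ‖x - z‖ with h | h <;> rw [hm, h] <;>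
      linarith [Real.rpow_nonneg (norm_nonneg (x - y)) (1 + α),
        Real.rpow_nonneg (norm_nonneg (x - z)) (1 + α)]
  have b1 : ‖z - y‖ ^ (1 + α) ≤ 4 * m ^ (1 + α) := by
    calc _ ≤ (2 * m) ^ (1 + α) := by gcongr
      _ = 2 ^ (1 + α) * m ^ (1 + α) := Real.mul_rpow (by norm_num) hm0
      _ ≤ _ := by gcongr
  have b2 : ‖z - y‖ ^ α ≤ 2 * m ^ α := by
    calc _ ≤ (2 * m) ^ α := by gcongr
      _ = 2 ^ α * m ^ α := Real.mul_rpow (by norm_num) hm0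
      _ ≤ _ := by gcongr
  have b3 : |(Gz - Gy) (x - z)| ≤ 2 * K * m ^ (1 + α) := by
    calc _ ≤ ‖Gz - Gy‖ * ‖x - z‖ := (Gz - Gy).le_opNorm _
      _ ≤ (K * (2 * m ^ α)) * m := by
          gcongr
          · exact hG.trans (by gcongr)
          · exact le_max_right _ _
      _ = _ := by rw [hmp]; ring
  have b4 := mul_le_mul_of_nonneg_left b1 hK
  have b5 := mul_le_mul_of_nonneg_left hsum hK
  have e : Gy (x - y) = Gy (z - y) + Gy (x - z) := by
    rw [← map_add]; congr 1; abel
  rw [sub_apply] at b3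
  have c1 := (abs_le.1 hf).1
  have c2 := (abs_le.1 b3).1
  rw [e]
  linarith

/-- A real `1`-jet satisfying the `C^{1,α}` compatibility conditions extends to a function whose
second differences are `O(‖h‖ ^ (1 + α))`. The extension is the largest midpoint-paraconvex function
below the lower envelope of the upper paraboloids of the jet. -/
theorem exists_extension_real {ι : Type*} [Nonempty ι] {α K : ℝ} (hα0 : 0 < α) (hα1 : α ≤ 1)
    (hK : 0 ≤ K) (p : ι → E) (f : ι → ℝ) (G : ι → E →L[ℝ] ℝ)
    (hf : ∀ i j, |f j - f i - G i (p j - p i)| ≤ K * ‖p j - p i‖ ^ (1 + α))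
    (hG : ∀ i j, ‖G j - G i‖ ≤ K * ‖p j - p i‖ ^ α) :
    ∃ F : E → ℝ, (∀ i, F (p i) = f i) ∧
      (∀ x h, |F (x + h) + F (x - h) - 2 * F x| ≤ 12 * K * ‖h‖ ^ (1 + α)) ∧
      ∀ x, ∃ B, ∀ h, ‖h‖ ≤ 1 → |F (x + h)| ≤ B := by
  set M := 6 * K with hM
  have hM0 : 0 ≤ M := by positivity
  set up : ι → E → ℝ := fun i x => f i + G i (x - p i) + M * ‖x - p i‖ ^ (1 + α) with hup
  set lo : ι → E → ℝ := fun i x => f i + G i (x - p i) - M * ‖x - p i‖ ^ (1 + α) with hlo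
  have hlu : ∀ i j x, lo i x ≤ up j x := fun i j x =>
    jet_lower_le_upper hα0 hα1 hK (hf i j) (hG i j)
  have hpow : ∀ i x h, M * ‖x + h - p i‖ ^ (1 + α) + M * ‖x - h - p i‖ ^ (1 + α)
      ≤ 2 * (M * ‖x - p i‖ ^ (1 + α)) + 2 * (M * ‖h‖ ^ (1 + α)) := by
    intro i x h
    have := mul_le_mul_of_nonneg_left
      (norm_rpow_add_add_norm_rpow_sub_le hα0 hα1 (x - p i) h) hM0
    rw [show x + h - p i = x - p i + h by abel, show x - h - p i = x - p i - h by abel]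
    linarith
  have hlin : ∀ i x h, G i (x + h - p i) + G i (x - h - p i) = 2 * G i (x - p i) := by
    intro i x h
    simp only [map_sub, map_add]; ring
  have hupc : ∀ i x h, up i (x + h) + up i (x - h) ≤ 2 * up i x + 2 * (M * ‖h‖ ^ (1 + α)) := by
    intro i x h
    simp only [hup]; linarith [hpow i x h, hlin i x h]
  have hloc : ∀ i x h, 2 * lo i x ≤ lo i (x + h) + lo i (x - h) + 2 * (M * ‖h‖ ^ (1 + α)) := by
    intro i x h
    simp only [hlo]; linarith [hpow i x h, hlin i x h]
  -- Both conditions survive pointwise suprema, so `S` has a largest element `F`. It is squeezed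
  -- between `lo i` and `up i`, which agree at `p i`.
  let S : Set (E → ℝ) := {e | (∀ x h, 2 * e x ≤ e (x + h) + e (x - h) + 2 * (M * ‖h‖ ^ (1 + α))) ∧
    ∀ i x, e x ≤ up i x}
  have hloS : ∀ i, lo i ∈ S := fun i => ⟨hloc i, fun j x => hlu i j x⟩
  let i₀ : ι := Classical.arbitrary ι
  have : Nonempty S := ⟨⟨lo i₀, hloS i₀⟩⟩
  have hbdd : ∀ x, BddAbove (Set.range fun e : S => e.1 x) := by
    rintro x
    refine ⟨up i₀ x, ?_⟩
    rintro _ ⟨e, rfl⟩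
    exact e.2.2 i₀ x
  let F : E → ℝ := fun x => ⨆ e : S, e.1 x
  have hle : ∀ e ∈ S, ∀ x, e x ≤ F x := fun e he x => le_ciSup (hbdd x) ⟨e, he⟩
  have hFup : ∀ i x, F x ≤ up i x := fun i x => ciSup_le fun e => e.2.2 i x
  have hFS : F ∈ S := by
    refine ⟨fun x h => ?_, hFup⟩
    have : F x ≤ (F (x + h) + F (x - h) + 2 * (M * ‖h‖ ^ (1 + α))) / 2 := by
      refine ciSup_le fun e => ?_
      linarith [e.2.1 x h, hle e.1 e.2 (x + h), hle e.1 e.2 (x - h)]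
    linarith
  have hconc : ∀ x h, F (x + h) + F (x - h) ≤ 2 * F x + 2 * (M * ‖h‖ ^ (1 + α)) := by
    intro x h
    -- Maximality gives the opposite inequality: this lowered average of translates of `F` is again
    -- a competitor in `S`, hence lies below `F`.
    have hS : (fun y => (F (y + h) + F (y - h)) / 2 - M * ‖h‖ ^ (1 + α)) ∈ S := by
      refine ⟨fun y k => ?_, fun i y => ?_⟩
      · have h1 := hFS.1 (y + h) k
        have h2 := hFS.1 (y - h) k
        rw [show y + h + k = y + k + h by abel, show y + h - k = y - k + h by abel] at h1
        rw [show y - h + k = y + k - h by abel, show y - h - k = y - k - h by abel] at h2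
        linarith
      · dsimp only
        linarith [hFup i (y + h), hFup i (y - h), hupc i y h]
    have := hle _ hS x
    linarith
  refine ⟨F, fun i => ?_, fun x h => ?_, fun x => ?_⟩
  · have hz : ‖p i - p i‖ ^ (1 + α) = 0 := by
      rw [sub_self, norm_zero, Real.zero_rpow (by linarith)]
    have h1 := hFup i (p i)
    have h2 := hle _ (hloS i) (p i)
    simp only [hup, hz] at h1
    simp only [hlo, hz] at h2
    simp only [sub_self, map_zero] at h1 h2
    linarith
  · rw [abs_le]
    constructor <;> linarith [hFS.1 x h, hconc x h]
  · set R := 1 + ‖x - p i₀‖ with hR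
    refine ⟨|f i₀| + ‖G i₀‖ * R + M * R ^ (1 + α), fun h hh => ?_⟩
    have hn : ‖x + h - p i₀‖ ≤ R := by
      rw [show x + h - p i₀ = h + (x - p i₀) by abel]
      exact (norm_add_le _ _).trans (by linarith)
    have h1 := hFup i₀ (x + h)
    have h2 := hle _ (hloS i₀) (x + h)
    simp only [hup] at h1
    simp only [hlo] at h2
    have h3 : |G i₀ (x + h - p i₀)| ≤ ‖G i₀‖ * R :=
      ((G i₀).le_opNorm _).trans (by gcongr)
    have h4 : M * ‖x + h - p i₀‖ ^ (1 + α) ≤ M * R ^ (1 + α) := by gcongr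
    rw [abs_le]
    constructor <;>
      linarith [(abs_le.1 h3).1, (abs_le.1 h3).2, le_abs_self (f i₀), neg_abs_le (f i₀)]

/-- **Whitney extension**, `C^{1,α}` case: a `1`-jet on an arbitrary family of points, with values in
a finite-dimensional inner product space, that satisfies the `C^{1,α}` compatibility conditions is
the restriction of a `C^{1,α}` function. -/
theorem exists_isC1Alpha_extension {ι : Type*} [Nonempty ι] {H : Type*} [NormedAddCommGroup H]
    [InnerProductSpace ℝ H] [FiniteDimensional ℝ H] {α K : ℝ} (hα0 : 0 < α) (hα1 : α ≤ 1)
    (hK : 0 ≤ K) (p : ι → E) (f : ι → H) (G : ι → E →L[ℝ] H)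
    (hf : ∀ i j, ‖f j - f i - G i (p j - p i)‖ ≤ K * ‖p j - p i‖ ^ (1 + α))
    (hG : ∀ i j, ‖G j - G i‖ ≤ K * ‖p j - p i‖ ^ α) :
    ∃ F : E → H, (∀ i, F (p i) = f i) ∧ IsC1Alpha α F := by
  let b := stdOrthonormalBasis ℝ H
  have hb : ∀ a, ‖innerSL ℝ (b a)‖ = 1 := fun a => by
    rw [innerSL_apply_norm]; exact b.orthonormal.1 a
  have hsc : ∀ a, ∃ F : E → ℝ, (∀ i, F (p i) = inner ℝ (b a) (f i)) ∧
      (∀ x h, |F (x + h) + F (x - h) - 2 * F x| ≤ 12 * K * ‖h‖ ^ (1 + α)) ∧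
      ∀ x, ∃ B, ∀ h, ‖h‖ ≤ 1 → |F (x + h)| ≤ B := by
    intro a
    refine exists_extension_real hα0 hα1 hK p (fun i => inner ℝ (b a) (f i))
      (fun i => (innerSL ℝ (b a)).comp (G i)) (fun i j => ?_) (fun i j => ?_)
    · refine le_trans ?_ (hf i j)
      have := (innerSL ℝ (b a)).le_opNorm (f j - f i - G i (p j - p i))
      rw [hb, one_mul] at this
      simpa [inner_sub_right] using this
    · refine le_trans ?_ (hG i j)
      rw [← ContinuousLinearMap.comp_sub]
      refine (ContinuousLinearMap.opNorm_comp_le _ _).trans ?_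
      rw [hb, one_mul]
  choose Φ hΦ1 hΦ2 hΦ3 using hsc
  refine ⟨fun x => ∑ a, Φ a x • b a, fun i => ?_, ?_⟩
  · simp only [hΦ1]; exact b.sum_repr' (f i)
  · refine isC1Alpha_of_second_difference (K := ∑ _a : Fin (Module.finrank ℝ H), 12 * K) hα0
      (by positivity) (fun x h => ?_) (fun x => ?_)
    · rw [← Finset.sum_add_distrib, Finset.smul_sum, ← Finset.sum_sub_distrib, Finset.sum_mul]
      refine (norm_sum_le _ _).trans (Finset.sum_le_sum fun a _ => ?_)
      rw [smul_smul, ← add_smul, ← sub_smul, norm_smul, b.orthonormal.1 a, mul_one]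
      exact hΦ2 a x h
    · choose B hB using fun a => hΦ3 a x
      refine ⟨∑ a, B a, fun h hh => (norm_sum_le _ _).trans (Finset.sum_le_sum fun a _ => ?_)⟩
      rw [norm_smul, b.orthonormal.1 a, mul_one]
      exact hB a h hh

end JetExtension

end

/-! ### Covering and volume estimates near a subspace. -/

noncomputable section

open MeasureTheory Metric

section Covering

theorem OrthonormalBasis.volume_box {ι E : Type*} [Fintype ι] [NormedAddCommGroup E]
    [InnerProductSpace ℝ E] [FiniteDimensional ℝ E] [MeasurableSpace E] [BorelSpace E]
    (b : OrthonormalBasis ι ℝ E) (z : E) (c : ι → ℝ) :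
    volume {w : E | ∀ i, |inner ℝ (b i) (w - z)| ≤ c i} = ∏ i, ENNReal.ofReal (2 * c i) := by
  have hmp : MeasurePreserving (fun w : E => WithLp.ofLp (b.repr w)) :=
    (PiLp.volume_preserving_ofLp ι).comp b.measurePreserving_repr
  have hset : {w : E | ∀ i, |inner ℝ (b i) (w - z)| ≤ c i}
      = (fun w : E => WithLp.ofLp (b.repr w)) ⁻¹'
        Set.Icc (fun i => inner ℝ (b i) z - c i) (fun i => inner ℝ (b i) z + c i) := by
    ext w
    simp only [Set.mem_ofPred_eq, Set.mem_preimage, Set.mem_Icc, Pi.le_def, ← forall_and,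
      inner_sub_right, abs_le, b.repr_apply_apply]
    refine forall_congr' fun i => ?_
    constructor <;> rintro ⟨h1, h2⟩ <;> constructor <;> linarith
  rw [hset, hmp.measure_preimage measurableSet_Icc.nullMeasurableSet, Real.volume_Icc_pi]
  refine Finset.prod_congr rfl fun i _ => ?_
  congr 1; ring

theorem Submodule.exists_adapted_orthonormalBasis {E : Type*} [NormedAddCommGroup E]
    [InnerProductSpace ℝ E] [FiniteDimensional ℝ E] (U : Submodule ℝ E) :
    ∃ b : OrthonormalBasis (Fin (Module.finrank ℝ U) ⊕ Fin (Module.finrank ℝ Uᗮ)) ℝ E,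
      ∀ j, b (Sum.inr j) ∈ Uᗮ := by
  let v : Fin (Module.finrank ℝ U) ⊕ Fin (Module.finrank ℝ Uᗮ) → E :=
    Sum.elim (fun i => (stdOrthonormalBasis ℝ U i : E)) fun j => (stdOrthonormalBasis ℝ Uᗮ j : E)
  have hv : Orthonormal ℝ v := by
    constructor
    · rintro (i | j)
      · exact (stdOrthonormalBasis ℝ U).orthonormal.1 i
      · exact (stdOrthonormalBasis ℝ Uᗮ).orthonormal.1 j
    · rintro (i | i) (j | j) hij
      · exact (stdOrthonormalBasis ℝ U).orthonormal.2 fun h => hij (by rw [h])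
      · exact U.inner_right_of_mem_orthogonal (SetLike.coe_mem _) (SetLike.coe_mem _)
      · exact U.inner_left_of_mem_orthogonal (SetLike.coe_mem _) (SetLike.coe_mem _)
      · exact (stdOrthonormalBasis ℝ Uᗮ).orthonormal.2 fun h => hij (by rw [h])
  have hcard : Module.finrank ℝ E
      = Fintype.card (Fin (Module.finrank ℝ U) ⊕ Fin (Module.finrank ℝ Uᗮ)) := by
    simp [U.finrank_add_finrank_orthogonal]
  obtain ⟨b, hb⟩ := Orthonormal.exists_orthonormalBasis_extension_of_card_eq hcard
    (v := v) (s := Set.univ) (hv.comp _ Subtype.val_injective)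
  exact ⟨b, fun j => by rw [hb _ (Set.mem_univ _)]; exact SetLike.coe_mem _⟩

/-- The volume of a tube of width `t` around an affine subspace, in a ball of radius `ρ`. -/
theorem volume_tube_le {n : ℕ} (U : Submodule ℝ (EuclideanSpace ℝ (Fin n)))
    (z : EuclideanSpace ℝ (Fin n)) {ρ t : ℝ} (hρ : 0 ≤ ρ) (ht : 0 ≤ t) :
    volume {w | ‖w - z‖ ≤ ρ ∧ ‖Uᗮ.starProjection (w - z)‖ ≤ t}
      ≤ ENNReal.ofReal ((2 * ρ) ^ Module.finrank ℝ U * (2 * t) ^ (n - Module.finrank ℝ U)) := by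
  obtain ⟨b, hb⟩ := U.exists_adapted_orthonormalBasis
  have hd : Module.finrank ℝ Uᗮ = n - Module.finrank ℝ U := by
    have := U.finrank_add_finrank_orthogonal
    rw [finrank_euclideanSpace_fin] at this
    omega
  calc _ ≤ volume {w | ∀ i, |inner ℝ (b i) (w - z)| ≤ Sum.elim (fun _ => ρ) (fun _ => t) i} := by
        refine measure_mono ?_
        rintro w ⟨h1, h2⟩ (i | j)
        · refine (abs_real_inner_le_norm _ _).trans ?_
          rw [b.orthonormal.1, one_mul]
          exact h1
        · have : inner ℝ (b (Sum.inr j)) (w - z)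
              = inner ℝ (b (Sum.inr j)) (Uᗮ.starProjection (w - z)) := by
            rw [← Submodule.inner_starProjection_left_eq_right,
              Submodule.starProjection_eq_self_iff.2 (hb j)]
          rw [this]
          refine (abs_real_inner_le_norm _ _).trans ?_
          rw [b.orthonormal.1, one_mul]
          exact h2
    _ = _ := by
        rw [b.volume_box, Fintype.prod_sum_type]
        simp only [Sum.elim_inl, Sum.elim_inr, Finset.prod_const, Finset.card_univ,
          Fintype.card_fin]
        rw [hd, ENNReal.ofReal_mul (p := (2 * ρ) ^ _) (by positivity), ENNReal.ofReal_pow (by positivity),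
          ENNReal.ofReal_pow (by positivity)]

theorem unitBallVolume_pos (n : ℕ) : 0 < unitBallVolume n :=
  ENNReal.toReal_pos (measure_closedBall_pos _ _ one_pos).ne' measure_closedBall_lt_top.ne

theorem volume_closedBall_eq_unitBallVolume {n : ℕ} (z : EuclideanSpace ℝ (Fin n)) {s : ℝ}
    (hs : 0 ≤ s) : volume (closedBall z s) = ENNReal.ofReal (s ^ n * unitBallVolume n) := by
  rw [Measure.addHaar_closedBall' _ _ hs, ENNReal.ofReal_mul (by positivity), unitBallVolume,
    ENNReal.ofReal_toReal measure_closedBall_lt_top.ne, finrank_euclideanSpace_fin]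

/-- The unit ball lies in a cube of side `2`, which is the tube bound for `U = ⊤`. -/
theorem unitBallVolume_le (n : ℕ) : unitBallVolume n ≤ 2 ^ n := by
  have h := volume_tube_le (⊤ : Submodule ℝ (EuclideanSpace ℝ (Fin n))) 0
    (zero_le_one (α := ℝ)) (zero_le_one (α := ℝ))
  have h2 : closedBall (0 : EuclideanSpace ℝ (Fin n)) 1 ⊆
      {w | ‖w - 0‖ ≤ 1 ∧ ‖(⊤ : Submodule ℝ (EuclideanSpace ℝ (Fin n)))ᗮ.starProjection (w - 0)‖
        ≤ 1} := by
    intro w hw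
    rw [mem_closedBall_zero_iff] at hw
    simpa using hw
  have h3 := (measure_mono h2).trans h
  rw [volume_closedBall_eq_unitBallVolume _ zero_le_one,
    ENNReal.ofReal_le_ofReal_iff (by positivity)] at h3
  simpa using h3

/-- A set in which every `t`-ball has `𝓗ᵏ`-measure at most `M tᵏ`, and which lies in the
`t`-neighbourhood of a `(k-1)`-plane, has `𝓗ᵏ`-measure at most of order `M rᵏ⁻¹ t`. -/
theorem measure_le_of_near_subspace {n m : ℕ} (hmn : m < n)
    (μ : Measure (EuclideanSpace ℝ (Fin n)))
    {S : Set (EuclideanSpace ℝ (Fin n))} {z : EuclideanSpace ℝ (Fin n)}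
    {U : Submodule ℝ (EuclideanSpace ℝ (Fin n))} (hU : Module.finrank ℝ U = m)
    {r t M : ℝ} (ht : 0 < t) (htr : t ≤ r) (hM : 0 ≤ M)
    (hSr : ∀ w ∈ S, ‖w - z‖ ≤ 2 * r)
    (hSt : ∀ w ∈ S, ‖Uᗮ.starProjection (w - z)‖ ≤ t)
    (hμ : ∀ w ∈ S, μ (S ∩ closedBall w t) ≤ ENNReal.ofReal (M * t ^ (m + 1))) :
    μ S ≤ ENNReal.ofReal (10 ^ n * M * r ^ m * t / unitBallVolume n) := by
  have hr : 0 < r := ht.trans_le htr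
  have hω := unitBallVolume_pos n
  lift t to NNReal using ht.le
  have hbd : Bornology.IsBounded S :=
    isBounded_closedBall.subset fun w hw => mem_closedBall_iff_norm.2 (hSr w hw)
  have htop : packingNumber t S ≠ ⊤ := by
    obtain ⟨N, -, hN, hcov⟩ := exists_finite_isCover_of_isCompact_closure (ε := t / 2)
      (by have : t ≠ 0 := by exact_mod_cast ht.ne'
          positivity) hbd.isCompact_closure
    have h1 := packingNumber_two_mul_le_externalCoveringNumber (t / 2) S
    rw [mul_div_cancel₀ _ two_ne_zero] at h1
    exact ((h1.trans hcov.externalCoveringNumber_le_encard).trans_lt hN.encard_lt_top).ne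
  -- The `t`-balls about `N` cover `S`, while the `t / 2`-balls are disjoint and lie in a tube about
  -- the plane; comparing volumes bounds the cardinality of `N`.
  set N := maximalSeparatedSet t S with hNdef
  have hNS : N ⊆ S := maximalSeparatedSet_subset
  have hNfin : N.Finite := by
    rw [← Set.encard_ne_top_iff, encard_maximalSeparatedSet htop]; exact htop
  have hNcov := isCover_iff_subset_iUnion_closedBall.1 (isCover_maximalSeparatedSet htop)
  have hNsep : IsSeparated (t : ENNReal) N := isSeparated_maximalSeparatedSet
  have hdisj : N.PairwiseDisjoint fun w => closedBall w ((t : ℝ) / 2) := by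
    intro w hw w' hw' hne
    refine closedBall_disjoint_closedBall ?_
    have : (t : ENNReal) < edist w w' := hNsep hw hw' hne
    rw [edist_nndist, ENNReal.coe_lt_coe] at this
    rw [add_halves]
    exact_mod_cast this
  set s := hNfin.toFinset with hs
  have hvol : (s.card : ℝ) * (((t : ℝ) / 2) ^ n * unitBallVolume n)
      ≤ (5 * r) ^ m * (3 * t) ^ (n - m) := by
    have h1 : volume (⋃ w ∈ s, closedBall w ((t : ℝ) / 2))
        ≤ ENNReal.ofReal ((2 * (2 * r + t / 2)) ^ m * (2 * (t + t / 2)) ^ (n - m)) := by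
      rw [← hU]
      refine le_trans (measure_mono ?_) (volume_tube_le U z (by positivity) (by positivity))
      intro v hv
      simp only [Set.mem_iUnion, hs, Set.Finite.mem_toFinset] at hv
      obtain ⟨w, hw, hvw⟩ := hv
      rw [mem_closedBall_iff_norm] at hvw
      have e : v - z = (w - z) + (v - w) := by abel
      refine ⟨?_, ?_⟩
      · rw [e]
        exact (norm_add_le _ _).trans (add_le_add (hSr w (hNS hw)) hvw)
      · rw [e, map_add]
        exact (norm_add_le _ _).trans (add_le_add (hSt w (hNS hw))
          ((Uᗮ.norm_starProjection_apply_le _).trans hvw))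
    rw [measure_biUnion_finset (by simpa [hs] using hdisj)
      fun w _ => measurableSet_closedBall] at h1
    simp only [volume_closedBall_eq_unitBallVolume _ (half_pos ht).le, Finset.sum_const,
      nsmul_eq_mul] at h1
    rw [← ENNReal.ofReal_natCast, ← ENNReal.ofReal_mul (by positivity),
      ENNReal.ofReal_le_ofReal_iff (by positivity)] at h1
    refine h1.trans ?_
    exact mul_le_mul (pow_le_pow_left₀ (by positivity) (by linarith) _)
      (pow_le_pow_left₀ (by positivity) (by linarith) _) (by positivity) (by positivity)
  have hcount : (s.card : ℝ) * (t : ℝ) ^ m ≤ 10 ^ n * r ^ m / unitBallVolume n := by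
    rw [le_div_iff₀ hω]
    have hn : n = m + (n - m) := by omega
    have h53 : (5 * r) ^ m * (3 * (t : ℝ)) ^ (n - m) ≤ 5 ^ n * r ^ m * (t : ℝ) ^ (n - m) := by
      calc _ ≤ (5 * r) ^ m * (5 * (t : ℝ)) ^ (n - m) := by gcongr; norm_num
        _ = 5 ^ (m + (n - m)) * r ^ m * (t : ℝ) ^ (n - m) := by rw [mul_pow, mul_pow, pow_add]; ring
        _ = _ := by rw [← hn]
    have h2 := hvol.trans h53
    have e1 : ((t : ℝ) / 2) ^ n = t ^ m * t ^ (n - m) / 2 ^ n := by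
      rw [div_pow, ← pow_add, ← hn]
    have e2 : (10 : ℝ) ^ n = 2 ^ n * 5 ^ n := by rw [← mul_pow]; norm_num
    rw [e1] at h2
    have h3 : (s.card : ℝ) * (t : ℝ) ^ m * unitBallVolume n * (t : ℝ) ^ (n - m)
        ≤ (10 ^ n * r ^ m) * (t : ℝ) ^ (n - m) := by
      rw [e2]
      have aux : ∀ a b c d e : ℝ, c ≠ 0 → d * a * e * b = c * (d * (a * b / c * e)) := by
        intros; field_simp
      calc _ = 2 ^ n * ((s.card : ℝ) * (t ^ m * t ^ (n - m) / 2 ^ n * unitBallVolume n)) := by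
            exact aux _ _ _ _ _ (by positivity)
        _ ≤ 2 ^ n * (5 ^ n * r ^ m * (t : ℝ) ^ (n - m)) := by gcongr
        _ = _ := by ring
    exact le_of_mul_le_mul_right h3 (by positivity)
  calc μ S ≤ μ (⋃ w ∈ s, S ∩ closedBall w t) := by
        refine measure_mono fun v hv => ?_
        have := hNcov hv
        simp only [Set.mem_iUnion, exists_prop] at this ⊢
        obtain ⟨w, hw, hvw⟩ := this
        exact ⟨w, by simpa [hs] using hw, hv, hvw⟩
    _ ≤ ∑ w ∈ s, μ (S ∩ closedBall w t) := measure_biUnion_finset_le _ _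
    _ ≤ ∑ w ∈ s, ENNReal.ofReal (M * (t : ℝ) ^ (m + 1)) :=
        Finset.sum_le_sum fun w hw => hμ w (hNS (by simpa [hs] using hw))
    _ = ENNReal.ofReal (s.card * (M * (t : ℝ) ^ (m + 1))) := by
        rw [Finset.sum_const, nsmul_eq_mul, ← ENNReal.ofReal_natCast,
          ← ENNReal.ofReal_mul (by positivity)]
    _ ≤ _ := by
        refine ENNReal.ofReal_le_ofReal ?_
        calc _ = (s.card * (t : ℝ) ^ m) * (M * t) := by ring
          _ ≤ (10 ^ n * r ^ m / unitBallVolume n) * (M * t) := by gcongr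
          _ = _ := by ring

end Covering

end

/-! ### The tilt estimate. -/

noncomputable section

open MeasureTheory Metric

section Tilt

theorem Submodule.starProjection_orthogonal_apply_eq_sub {E : Type*} [NormedAddCommGroup E]
    [InnerProductSpace ℝ E] [FiniteDimensional ℝ E] (V : Submodule ℝ E) (u : E) :
    Vᗮ.starProjection u = u - V.starProjection u :=
  eq_sub_of_add_eq' (V.starProjection_add_starProjection_orthogonal u)

/-- If `‖P_{W^⊥} P_V‖ > c`, then there is a hyperplane `U` of `V` such that any vector which is
close to both `V` and `W` is close to `U`. -/
theorem exists_hyperplane_near {E : Type*} [NormedAddCommGroup E] [InnerProductSpace ℝ E]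
    [FiniteDimensional ℝ E] {m : ℕ} {V W : Submodule ℝ E} (hV : Module.finrank ℝ V = m + 1)
    {c : ℝ} (hc : 0 < c) (hVW : c < ‖Wᗮ.starProjection ∘L V.starProjection‖) :
    ∃ U : Submodule ℝ E, Module.finrank ℝ U = m ∧ ∀ u, ‖Uᗮ.starProjection u‖
      ≤ ‖Vᗮ.starProjection u‖ + ‖Wᗮ.starProjection (V.starProjection u)‖ / c := by
  obtain ⟨v, hv⟩ : ∃ v, c * ‖v‖ < ‖Wᗮ.starProjection (V.starProjection v)‖ := by
    by_contra! h
    exact absurd (ContinuousLinearMap.opNorm_le_bound _ hc.le h) (not_le.2 hVW)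
  set T : E → E := fun u => Wᗮ.starProjection (V.starProjection u) with hT
  -- With `T = P_{W^⊥} P_V` this is `w = T* T v`, so `⟨w, u⟩ = ⟨T v, T u⟩` and `‖w‖ ≥ c * ‖T v‖`.
  -- The component of `u` along `w` is then at most `‖T u‖ / c`, and `U` is the complement of `w` in
  -- `V`.
  set w := V.starProjection (T v) with hw
  have hwV : w ∈ V := V.starProjection_apply_mem _
  have hinner : ∀ u, inner ℝ w u = inner ℝ (T v) (T u) := by
    intro u
    rw [hw, V.inner_starProjection_left_eq_right, hT]
    dsimp only
    rw [← Wᗮ.inner_starProjection_left_eq_right,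
      Submodule.starProjection_eq_self_iff.2 (Wᗮ.starProjection_apply_mem _)]
  have hv0 : 0 < ‖v‖ := by
    refine norm_pos_iff.2 ?_
    rintro rfl
    simp at hv
  have hTv : 0 < ‖T v‖ := lt_of_le_of_lt (by positivity) hv
  have hwc : c * ‖T v‖ ≤ ‖w‖ := by
    have h1 : ‖T v‖ ^ 2 ≤ ‖w‖ * ‖v‖ := by
      rw [← real_inner_self_eq_norm_sq, ← hinner]
      exact real_inner_le_norm _ _
    have h2 : (c * ‖T v‖) * ‖v‖ ≤ ‖w‖ * ‖v‖ := by
      have : c * ‖v‖ * ‖T v‖ ≤ ‖T v‖ * ‖T v‖ := by gcongr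
      linarith
    exact le_of_mul_le_mul_right h2 hv0
  have hw0 : 0 < ‖w‖ := lt_of_lt_of_le (by positivity) hwc
  refine ⟨(ℝ ∙ w)ᗮ ⊓ V, ?_, fun u => ?_⟩
  · have h1 := Submodule.finrank_add_inf_finrank_orthogonal
      ((Submodule.span_singleton_le_iff_mem w V).2 hwV)
    rw [finrank_span_singleton (norm_pos_iff.1 hw0), hV] at h1
    omega
  · set U := (ℝ ∙ w)ᗮ ⊓ V
    set a : ℝ := inner ℝ w u / ‖w‖ ^ 2 with ha
    set q := V.starProjection u - a • w with hq
    have hqU : q ∈ U := by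
      refine ⟨Submodule.mem_orthogonal_singleton_iff_inner_right.2 ?_,
        V.sub_mem (V.starProjection_apply_mem _) (V.smul_mem _ hwV)⟩
      rw [hq, inner_sub_right, inner_smul_right, real_inner_self_eq_norm_sq,
        ← V.inner_starProjection_left_eq_right, Submodule.starProjection_eq_self_iff.2 hwV, ha]
      field_simp
      simp
    have h1 : Uᗮ.starProjection u = Uᗮ.starProjection (u - q) := by
      rw [map_sub, Submodule.starProjection_orthogonal_apply_eq_sub U q,
        Submodule.starProjection_eq_self_iff.2 hqU, sub_self, sub_zero]
    have h2 : u - q = Vᗮ.starProjection u + a • w := by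
      rw [hq, V.starProjection_orthogonal_apply_eq_sub]; abel
    have h3 : ‖a • w‖ ≤ ‖T u‖ / c := by
      rw [norm_smul, ha, norm_div, norm_pow, norm_norm, hinner, le_div_iff₀ hc]
      have h4 : ‖inner ℝ (T v) (T u)‖ ≤ ‖T v‖ * ‖T u‖ := norm_inner_le_norm _ _
      calc _ = ‖inner ℝ (T v) (T u)‖ * c / ‖w‖ := by field_simp
        _ ≤ (‖T v‖ * ‖T u‖) * c / ‖w‖ := by gcongr
        _ = (c * ‖T v‖) * ‖T u‖ / ‖w‖ := by ring
        _ ≤ ‖w‖ * ‖T u‖ / ‖w‖ := by gcongr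
        _ = ‖T u‖ := by field_simp
    rw [h1]
    refine (Uᗮ.norm_starProjection_apply_le _).trans ?_
    rw [h2]
    exact (norm_add_le _ _).trans (by gcongr)

/-- Here `P_V - P_W = P_{W^⊥} P_V - P_W P_{V^⊥}`, and the last product is the adjoint of `P_{V^⊥}
P_W`. -/
theorem planeDist_le_add {n : ℕ} (V W : Submodule ℝ (EuclideanSpace ℝ (Fin n))) :
    planeDist V W ≤ ‖Wᗮ.starProjection ∘L V.starProjection‖
      + ‖Vᗮ.starProjection ∘L W.starProjection‖ := by
  have e : V.starProjection - W.starProjection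
      = Wᗮ.starProjection ∘L V.starProjection - W.starProjection ∘L Vᗮ.starProjection := by
    ext1 u
    simp only [ContinuousLinearMap.comp_apply, sub_apply,
      Submodule.starProjection_orthogonal_apply_eq_sub, map_sub]
    abel
  have h : ‖W.starProjection ∘L Vᗮ.starProjection‖
      = ‖Vᗮ.starProjection ∘L W.starProjection‖ := by
    rw [← ContinuousLinearMap.adjoint.norm_map, ContinuousLinearMap.adjoint_comp,
      isSelfAdjoint_starProjection W |>.adjoint_eq, isSelfAdjoint_starProjection Vᗮ |>.adjoint_eq]
  rw [planeDist, e, ← h]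
  exact norm_sub_le _ _

/-- With `s = 2 ^ k` this is `(3 * s + 1) * (s - 2) ≥ 0`, an equality at `k = 1`. It determines the
split of `δ` into a lost part `3 / 5` and a kept part `2 / 5`. -/
theorem five_mul_one_add_two_pow_le {k : ℕ} (hk : 1 ≤ k) :
    5 * (1 + (2 : ℝ) ^ k) ≤ 3 * (4 ^ k + 1) := by
  have h2 : (2 : ℝ) ≤ 2 ^ k := by
    simpa using pow_le_pow_right₀ (one_le_two : (1 : ℝ) ≤ 2) hk
  have h4 : (4 : ℝ) ^ k = 2 ^ k * 2 ^ k := by rw [← mul_pow]; norm_num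
  rw [h4]
  nlinarith

/-- The part of `F ∩ B(x, |x - y|)` lying in both paraboloids has large measure. -/
theorem le_measure_inter_paraboloid {n k : ℕ} (hk : 1 ≤ k)
    (μ : Measure (EuclideanSpace ℝ (Fin n))) {α r₀ lam δ ε : ℝ} (hδ : 0 < δ)
    (hε : ε < 1 / (4 ^ k + 1) * δ) {F : Set (EuclideanSpace ℝ (Fin n))}
    {x y : EuclideanSpace ℝ (Fin n)} {Vx Vy : Submodule ℝ (EuclideanSpace ℝ (Fin n))}
    (hlower : ∀ r : ℝ, 0 < r → r ≤ r₀ → ENNReal.ofReal (δ * r ^ k) ≤ μ (F ∩ closedBall x r))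
    (hx : ∀ r : ℝ, 0 < r → r ≤ r₀ →
      μ ((F ∩ closedBall x r) \ paraboloid α x Vx lam) ≤ ENNReal.ofReal (ε * r ^ k))
    (hy : ∀ r : ℝ, 0 < r → r ≤ r₀ →
      μ ((F ∩ closedBall y r) \ paraboloid α y Vy lam) ≤ ENNReal.ofReal (ε * r ^ k))
    {r : ℝ} (hr : 0 < r) (hrr : 2 * r ≤ r₀) (hxy : ‖x - y‖ ≤ r) :
    ENNReal.ofReal (2 / 5 * δ * r ^ k) ≤
      μ (F ∩ closedBall x r ∩ (paraboloid α x Vx lam ∩ paraboloid α y Vy lam)) := by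
  set S := F ∩ closedBall x r ∩ (paraboloid α x Vx lam ∩ paraboloid α y Vy lam) with hS
  -- The bad set of `y` is measured in `B(y, 2r)`, which contains `B(x, r)`; hence the factor `1 + 2
  -- ^ k`.
  have hsub : F ∩ closedBall x r ⊆ S ∪ (((F ∩ closedBall x r) \ paraboloid α x Vx lam) ∪
      ((F ∩ closedBall y (2 * r)) \ paraboloid α y Vy lam)) := by
    rintro w ⟨hwF, hwx⟩
    by_cases h1 : w ∈ paraboloid α x Vx lam
    · by_cases h2 : w ∈ paraboloid α y Vy lam
      · exact Or.inl ⟨⟨hwF, hwx⟩, h1, h2⟩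
      · refine Or.inr (Or.inr ⟨⟨hwF, ?_⟩, h2⟩)
        rw [mem_closedBall_iff_norm] at hwx ⊢
        rw [show w - y = (w - x) + (x - y) by abel]
        exact (norm_add_le _ _).trans (by linarith)
    · exact Or.inr (Or.inl ⟨⟨hwF, hwx⟩, h1⟩)
  -- The sign of `ε` is unrestricted; `max ε 0` allows the two `ofReal` terms to be added.
  have hε' : max ε 0 * (1 + 2 ^ k) ≤ 3 / 5 * δ := by
    have h1 : max ε 0 ≤ 1 / (4 ^ k + 1) * δ := max_le hε.le (by positivity)
    calc _ ≤ 1 / (4 ^ k + 1) * δ * (1 + 2 ^ k) := by gcongr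
      _ = (5 * (1 + 2 ^ k)) * (δ / (5 * (4 ^ k + 1))) := by field_simp
      _ ≤ (3 * (4 ^ k + 1)) * (δ / (5 * (4 ^ k + 1))) := by
          gcongr ?_ * _; exact five_mul_one_add_two_pow_le hk
      _ = _ := by field_simp
  have hmain : ENNReal.ofReal (2 / 5 * δ * r ^ k) + ENNReal.ofReal (3 / 5 * δ * r ^ k)
      ≤ μ S + ENNReal.ofReal (3 / 5 * δ * r ^ k) := by
    rw [← ENNReal.ofReal_add (by positivity) (by positivity)]
    calc _ = ENNReal.ofReal (δ * r ^ k) := by congr 1; ring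
      _ ≤ μ (F ∩ closedBall x r) := hlower r hr (by linarith)
      _ ≤ μ S + (μ ((F ∩ closedBall x r) \ paraboloid α x Vx lam)
          + μ ((F ∩ closedBall y (2 * r)) \ paraboloid α y Vy lam)) :=
        (measure_mono hsub).trans ((measure_union_le _ _).trans
          (by gcongr; exact measure_union_le _ _))
      _ ≤ μ S + (ENNReal.ofReal (max ε 0 * r ^ k) + ENNReal.ofReal (max ε 0 * (2 * r) ^ k)) := by
        gcongr
        · refine (hx r hr (by linarith)).trans (ENNReal.ofReal_le_ofReal ?_)
          gcongr; exact le_max_left _ _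
        · refine (hy (2 * r) (by positivity) hrr).trans (ENNReal.ofReal_le_ofReal ?_)
          gcongr; exact le_max_left _ _
      _ ≤ _ := by
        rw [← ENNReal.ofReal_add (by positivity) (by positivity)]
        gcongr
        rw [mul_pow]
        calc _ = max ε 0 * (1 + 2 ^ k) * r ^ k := by ring
          _ ≤ _ := by gcongr
  exact (ENNReal.add_le_add_iff_right ENNReal.ofReal_ne_top).1 hmain

theorem norm_le_of_mem_paraboloid {n : ℕ} {α lam : ℝ} (hα : 0 ≤ α) (hlam : 0 ≤ lam)
    {x z : EuclideanSpace ℝ (Fin n)} {V : Submodule ℝ (EuclideanSpace ℝ (Fin n))}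
    (hz : z ∈ paraboloid α x V lam) {r : ℝ} (hr : ‖z - x‖ ≤ r) :
    ‖Vᗮ.starProjection (z - x)‖ ≤ lam * r ^ (1 + α) := by
  refine le_trans hz ?_
  gcongr
  exact (V.norm_starProjection_apply_le _).trans hr

theorem two_mul_rpow_one_add_le {α r : ℝ} (hα1 : α ≤ 1) (hr : 0 ≤ r) :
    (2 * r) ^ (1 + α) ≤ 4 * r ^ (1 + α) := by
  rw [Real.mul_rpow (by norm_num) hr]
  gcongr
  calc (2 : ℝ) ^ (1 + α) ≤ 2 ^ (2 : ℝ) := by gcongr <;> linarith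
    _ = 4 := by norm_num

theorem tiltConst_pos {n : ℕ} (hn : 0 < n) {δ M lam : ℝ} (hδ : 0 < δ) (hM : 0 < M)
    (hlam : 0 < lam) : 0 < tiltConst n δ M lam := by
  have := unitBallVolume_pos n
  unfold tiltConst
  positivity

/-- Ensures that the covering scale `t = 24 * lam * r / C` does not exceed `r`. -/
theorem le_tiltConst {n : ℕ} (hn : 0 < n) {δ M lam : ℝ} (hδ : 0 < δ) (hδM : δ ≤ M)
    (hlam : 0 < lam) : 24 * lam ≤ tiltConst n δ M lam := by
  have hω := unitBallVolume_pos n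
  have hn1 : (1 : ℝ) ≤ n := by exact_mod_cast hn
  have hM : 0 < M := hδ.trans_le hδM
  unfold tiltConst
  rw [le_div_iff₀ (by positivity)]
  have h20 : (2 : ℝ) ^ n ≤ 20 ^ n := by gcongr; norm_num
  calc 24 * lam * (δ * unitBallVolume n) ≤ 24 * lam * (M * 20 ^ n) := by
        gcongr; exact (unitBallVolume_le n).trans h20
    _ = 20 ^ n * 24 * 1 * M * lam := by ring
    _ ≤ 20 ^ n * 40 * n * M * lam := by gcongr; norm_num
    _ = _ := by rw [pow_succ]; ring

/-- The constant `60` is `24 * 5 / 2`, from the width `24 * lam * r / C` and the mass fraction `2 /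
5`; this strict inequality closes the tilt contradiction. -/
theorem lt_tiltConst {n : ℕ} (hn : 0 < n) {δ M lam : ℝ} (hδ : 0 < δ) (hM : 0 < M)
    (hlam : 0 < lam) :
    60 * 10 ^ n * M * lam < tiltConst n δ M lam * (δ * unitBallVolume n) := by
  have hω := unitBallVolume_pos n
  have hn1 : (1 : ℝ) ≤ n := by exact_mod_cast hn
  unfold tiltConst
  rw [div_mul_cancel₀ _ (by positivity)]
  have h1 : 2 * (10 : ℝ) ^ n ≤ 20 ^ n := by
    have h2 : (2 : ℝ) ≤ 2 ^ n := by
      simpa using pow_le_pow_right₀ (one_le_two : (1 : ℝ) ≤ 2) (Nat.succ_le_of_lt hn)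
    calc 2 * (10 : ℝ) ^ n ≤ 2 ^ n * 10 ^ n := by gcongr
      _ = _ := by rw [← mul_pow]; norm_num
  calc 60 * 10 ^ n * M * lam < 80 * 10 ^ n * M * lam := by gcongr; norm_num
    _ = (2 * 10 ^ n) * 40 * 1 * M * lam := by ring
    _ ≤ 20 ^ n * 40 * n * M * lam := by gcongr
    _ = _ := by rw [pow_succ]; ring

/-- One-sided tilt estimate for two planes whose paraboloids share a large part of `F`. -/
theorem norm_starProjection_comp_le {n m : ℕ} (hmn : m < n)
    (μ : Measure (EuclideanSpace ℝ (Fin n))) {α r₀ lam δ M : ℝ} (hα0 : 0 < α) (hα1 : α ≤ 1)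
    (hlam : 0 < lam) (hδ : 0 < δ) (hδM : δ ≤ M) {F : Set (EuclideanSpace ℝ (Fin n))}
    (hupper : ∀ x ∈ F, ∀ r : ℝ, 0 < r → r ≤ r₀ →
      μ (F ∩ closedBall x r) ≤ ENNReal.ofReal (M * r ^ (m + 1)))
    {x y : EuclideanSpace ℝ (Fin n)} {Vx Vy : Submodule ℝ (EuclideanSpace ℝ (Fin n))}
    (hVx : Module.finrank ℝ Vx = m + 1) {r : ℝ} (hr : 0 < r) (hrr : r ≤ r₀) (hxy : ‖x - y‖ ≤ r)
    (hS : ENNReal.ofReal (2 / 5 * δ * r ^ (m + 1)) ≤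
      μ (F ∩ closedBall x r ∩ (paraboloid α x Vx lam ∩ paraboloid α y Vy lam))) :
    ‖Vyᗮ.starProjection ∘L Vx.starProjection‖ ≤ tiltConst n δ M lam / 2 * r ^ α := by
  set S := F ∩ closedBall x r ∩ (paraboloid α x Vx lam ∩ paraboloid α y Vy lam) with hSdef
  have hn : 0 < n := by omega
  have hM : 0 < M := hδ.trans_le hδM
  set C := tiltConst n δ M lam with hCdef
  have hC : 0 < C := tiltConst_pos hn hδ hM hlam
  have hω := unitBallVolume_pos n
  obtain ⟨z₀, hz₀⟩ : S.Nonempty := by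
    refine nonempty_of_measure_ne_zero (μ := μ) (ne_of_gt (lt_of_lt_of_le ?_ hS))
    exact ENNReal.ofReal_pos.2 (by positivity)
  set e := lam * r ^ (1 + α) with he
  have he0 : 0 < e := by positivity
  have hzx : ∀ z ∈ S, ‖z - x‖ ≤ r := fun z hz => mem_closedBall_iff_norm.1 hz.1.2
  have h1 : ∀ z ∈ S, ‖Vxᗮ.starProjection (z - x)‖ ≤ e := fun z hz =>
    norm_le_of_mem_paraboloid hα0.le hlam.le hz.2.1 (hzx z hz)
  have h2 : ∀ z ∈ S, ‖Vyᗮ.starProjection (z - y)‖ ≤ 4 * e := by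
    intro z hz
    have hzy : ‖z - y‖ ≤ 2 * r := by
      rw [show z - y = (z - x) + (x - y) by abel]
      exact (norm_add_le _ _).trans (by linarith [hzx z hz])
    refine (norm_le_of_mem_paraboloid hα0.le hlam.le hz.2.2 hzy).trans ?_
    calc _ ≤ lam * (4 * r ^ (1 + α)) := by gcongr; exact two_mul_rpow_one_add_le hα1 hr.le
      _ = _ := by rw [he]; ring
  by_contra! hcon
  set c := C / 2 * r ^ α with hc
  have hc0 : 0 < c := by positivity
  have hc1 : c ≤ 1 := by
    refine hcon.le.trans (ContinuousLinearMap.opNorm_le_bound _ zero_le_one fun u => ?_)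
    rw [one_mul]
    exact (Vyᗮ.norm_starProjection_apply_le _).trans (Vx.norm_starProjection_apply_le _)
  obtain ⟨U, hU, hUn⟩ := exists_hyperplane_near hVx hc0 hcon
  -- The distance to `U` is at most `2 * e + 10 * e / c`, and `c ≤ 1` absorbs the first term. The
  -- powers `r ^ α` cancel, so `t` is linear in `r`.
  set t := 12 * e / c with ht
  have ht0 : 0 < t := by positivity
  have hteq : t = 24 * lam * r / C := by
    rw [ht, he, hc, Real.rpow_add hr, Real.rpow_one]
    have : r ^ α ≠ 0 := by positivity
    field_simp
    ring
  have htr : t ≤ r := by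
    rw [hteq, div_le_iff₀ hC, mul_comm r C]
    gcongr
    exact le_tiltConst hn hδ hδM hlam
  have hSt : ∀ z ∈ S, ‖Uᗮ.starProjection (z - z₀)‖ ≤ t := by
    intro z hz
    have a1 : ‖Vxᗮ.starProjection (z - z₀)‖ ≤ 2 * e := by
      rw [show z - z₀ = (z - x) - (z₀ - x) by abel, map_sub]
      exact (norm_sub_le _ _).trans (by linarith [h1 z hz, h1 z₀ hz₀])
    have a2 : ‖Vyᗮ.starProjection (z - z₀)‖ ≤ 8 * e := by
      rw [show z - z₀ = (z - y) - (z₀ - y) by abel, map_sub]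
      exact (norm_sub_le _ _).trans (by linarith [h2 z hz, h2 z₀ hz₀])
    have a3 : ‖Vyᗮ.starProjection (Vx.starProjection (z - z₀))‖ ≤ 10 * e := by
      have : Vx.starProjection (z - z₀) = (z - z₀) - Vxᗮ.starProjection (z - z₀) := by
        rw [Submodule.starProjection_orthogonal_apply_eq_sub]; abel
      rw [this, map_sub]
      exact (norm_sub_le _ _).trans (by
        linarith [Vyᗮ.norm_starProjection_apply_le (Vxᗮ.starProjection (z - z₀))])
    calc _ ≤ 2 * e + 10 * e / c := (hUn _).trans (by gcongr)
      _ ≤ 2 * e / c + 10 * e / c := by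
          gcongr
          rw [le_div_iff₀ hc0]
          exact mul_le_of_le_one_right (by positivity) hc1
      _ = t := by rw [ht]; ring
  have hSr : ∀ z ∈ S, ‖z - z₀‖ ≤ 2 * r := by
    intro z hz
    rw [show z - z₀ = (z - x) - (z₀ - x) by abel]
    exact (norm_sub_le _ _).trans (by linarith [hzx z hz, hzx z₀ hz₀])
  have hμ : ∀ w ∈ S, μ (S ∩ closedBall w t) ≤ ENNReal.ofReal (M * t ^ (m + 1)) := fun w hw =>
    (measure_mono (Set.inter_subset_inter_left _ fun v hv => hv.1.1)).trans
      (hupper w hw.1.1 t ht0 (htr.trans hrr))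
  have hfin := hS.trans (measure_le_of_near_subspace hmn μ hU ht0 htr hM.le hSr hSt hμ)
  rw [ENNReal.ofReal_le_ofReal_iff (by positivity), le_div_iff₀ hω, hteq] at hfin
  have h5 : (r ^ (m + 1) * 2) * (C * (δ * unitBallVolume n))
      ≤ (r ^ (m + 1) * 2) * (60 * 10 ^ n * M * lam) := by
    calc _ = 5 * C * (2 / 5 * δ * r ^ (m + 1) * unitBallVolume n) := by ring
      _ ≤ 5 * C * (10 ^ n * M * r ^ m * (24 * lam * r / C)) := by gcongr
      _ = _ := by rw [pow_succ]; field_simp; ring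
  exact absurd (le_of_mul_le_mul_left h5 (by positivity)) (not_le.2 (lt_tiltConst hn hδ hM hlam))

end Tilt

end

/-! ### From tangent planes to a single graph. -/

noncomputable section

open MeasureTheory Metric

section Graph

variable {n : ℕ} {V W : Submodule ℝ (EuclideanSpace ℝ (Fin n))}

theorem norm_starProjection_sub_le (V W : Submodule ℝ (EuclideanSpace ℝ (Fin n)))
    (u : EuclideanSpace ℝ (Fin n)) :
    ‖V.starProjection u - W.starProjection u‖ ≤ planeDist V W * ‖u‖ :=
  (V.starProjection - W.starProjection).le_opNorm u

/-- A vector orthogonal to `W` is almost orthogonal to the nearby plane `V`. Both jet conditions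
reduce to bounding such vectors. -/
theorem norm_le_two_mul_of_starProjection_eq_zero (hVW : planeDist V W ≤ 1 / 8)
    {q : EuclideanSpace ℝ (Fin n)} (hq : W.starProjection q = 0) :
    ‖q‖ ≤ 2 * ‖Vᗮ.starProjection q‖ := by
  have h1 := norm_starProjection_sub_le V W q
  rw [hq, sub_zero] at h1
  have h2 : ‖q‖ ≤ ‖V.starProjection q‖ + ‖Vᗮ.starProjection q‖ := by
    conv_lhs => rw [← V.starProjection_add_starProjection_orthogonal q]
    exact norm_add_le _ _
  nlinarith [norm_nonneg q]

theorem starProjection_orthogonal_eq_zero {E : Type*} [NormedAddCommGroup E]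
    [InnerProductSpace ℝ E] [FiniteDimensional ℝ E] {V : Submodule ℝ E} {v : E} (hv : v ∈ V) :
    Vᗮ.starProjection v = 0 := by
  rw [Submodule.starProjection_orthogonal_apply_eq_sub,
    Submodule.starProjection_eq_self_iff.2 hv, sub_self]

/-- A plane `V` close to `W` is the graph of a linear map over `W`: there is a bounded right inverse
`W → V` of the orthogonal projection onto `W`. -/
theorem exists_lift_of_planeDist_le (hfr : Module.finrank ℝ V = Module.finrank ℝ W)
    (hVW : planeDist V W ≤ 1 / 8) :
    ∃ J : W →L[ℝ] EuclideanSpace ℝ (Fin n), (∀ w, J w ∈ V) ∧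
      (∀ w, W.orthogonalProjectionOnto (J w) = w) ∧ ∀ w, ‖J w‖ ≤ 2 * ‖w‖ := by
  let φ : V →ₗ[ℝ] W := W.orthogonalProjectionOnto.toLinearMap ∘ₗ V.subtype
  have hφ : ∀ v : V, ‖v‖ ≤ 2 * ‖φ v‖ := by
    intro v
    have h1 := norm_starProjection_sub_le V W v
    rw [Submodule.starProjection_eq_self_iff.2 v.2] at h1
    have h2 : ‖(v : EuclideanSpace ℝ (Fin n))‖
        ≤ ‖(v : EuclideanSpace ℝ (Fin n)) - W.starProjection v‖ + ‖W.starProjection v‖ := by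
      simpa using norm_add_le ((v : EuclideanSpace ℝ (Fin n)) - W.starProjection v)
        (W.starProjection v)
    have h3 : ‖φ v‖ = ‖W.starProjection (v : EuclideanSpace ℝ (Fin n))‖ := rfl
    have h4 : ‖v‖ = ‖(v : EuclideanSpace ℝ (Fin n))‖ := rfl
    rw [h3, h4]
    nlinarith [norm_nonneg (v : EuclideanSpace ℝ (Fin n))]
  have hinj : Function.Injective φ := by
    rw [injective_iff_map_eq_zero]
    intro v hv
    have := hφ v
    rw [hv, norm_zero, mul_zero] at this
    exact norm_le_zero_iff.1 this
  let e := LinearEquiv.ofInjectiveOfFinrankEq φ hinj hfr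
  have he : ∀ w, φ (e.symm w) = w := fun w => e.apply_symm_apply w
  refine ⟨LinearMap.toContinuousLinearMap (V.subtype ∘ₗ e.symm.toLinearMap), fun w =>
    (e.symm w).2, he, fun w => ?_⟩
  have := hφ (e.symm w)
  rw [he] at this
  exact this

/-- A set whose points carry `k`-planes which vary in a Hölder continuous way and are tangent to the
set at order `1 + α`, at a scale at which both variations are small, is contained in a `C^{1,α}`
graph. -/
theorem exists_isC1AlphaGraph_of_tangent {k : ℕ} {α D : ℝ} (hα0 : 0 < α) (hα1 : α ≤ 1)
    (hD : 0 ≤ D) {A : Set (EuclideanSpace ℝ (Fin n))} (hA : A.Nonempty)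
    {V : EuclideanSpace ℝ (Fin n) → Submodule ℝ (EuclideanSpace ℝ (Fin n))}
    (hV : ∀ x ∈ A, Module.finrank ℝ (V x) = k)
    (hdist : ∀ x ∈ A, ∀ y ∈ A, planeDist (V x) (V y) ≤ D * ‖y - x‖ ^ α)
    (htan : ∀ x ∈ A, ∀ y ∈ A, ‖(V x)ᗮ.starProjection (y - x)‖ ≤ D * ‖y - x‖ ^ (1 + α))
    (hdist' : ∀ x ∈ A, ∀ y ∈ A, planeDist (V x) (V y) ≤ 1 / 8)
    (htan' : ∀ x ∈ A, ∀ y ∈ A, ‖(V x)ᗮ.starProjection (y - x)‖ ≤ 1 / 4 * ‖y - x‖) :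
    ∃ Γ : Set (EuclideanSpace ℝ (Fin n)), IsC1AlphaGraph k α Γ ∧ A ⊆ Γ := by
  obtain ⟨x₀, hx₀⟩ := hA
  set W := V x₀ with hW
  have hlift := fun x : A => exists_lift_of_planeDist_le (V := V x) (W := W)
    ((hV x x.2).trans (hV x₀ hx₀).symm) (hdist' x x.2 x₀ hx₀)
  choose J hJV hJW hJn using hlift
  have hJs : ∀ x w, W.starProjection (J x w) = w := fun x w => by
    rw [← Submodule.coe_orthogonalProjectionOnto_apply, hJW]
  have : Nonempty A := ⟨⟨x₀, hx₀⟩⟩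
  let p : A → W := fun x => W.orthogonalProjectionOnto x
  let f : A → Wᗮ := fun x => Wᗮ.orthogonalProjectionOnto x
  -- `G x` is the slope of `V x` viewed as a graph over `W`.
  let G : A → W →L[ℝ] Wᗮ := fun x => Wᗮ.orthogonalProjectionOnto ∘L J x
  -- Since `1 / 4 + 1 / 8 ≤ 1 / 2`, at least half of `y - x` survives projection to `W`.
  have hbase : ∀ x y : A, ‖(y : EuclideanSpace ℝ (Fin n)) - x‖ ≤ 2 * ‖p y - p x‖ := by
    intro x y
    set u := (y : EuclideanSpace ℝ (Fin n)) - x with hu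
    have h1 : ‖p y - p x‖ = ‖W.starProjection u‖ := by
      simp only [p]
      rw [← map_sub]; rfl
    have h2 := norm_starProjection_sub_le (V x) W u
    have h3 := htan' x x.2 y y.2
    have h4 : u = (V x)ᗮ.starProjection u
        + (((V x).starProjection u - W.starProjection u) + W.starProjection u) := by
      rw [Submodule.starProjection_orthogonal_apply_eq_sub]; abel
    have h5 : ‖u‖ ≤ ‖(V x)ᗮ.starProjection u‖
        + (‖(V x).starProjection u - W.starProjection u‖ + ‖W.starProjection u‖) := by
      conv_lhs => rw [h4]
      exact (norm_add_le _ _).trans (by gcongr; exact norm_add_le _ _)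
    rw [h1]
    nlinarith [norm_nonneg u, hdist' x x.2 x₀ hx₀]
  have h2α : (2 : ℝ) ^ α ≤ 2 := by
    simpa using Real.rpow_le_rpow_of_exponent_le (by norm_num : (1 : ℝ) ≤ 2) hα1
  -- The factor `8` is `2 * 4` for the values and `2 * 2 * 2` for the slopes.
  obtain ⟨Φ, hΦ, hΦC⟩ := exists_isC1Alpha_extension (K := 8 * D) hα0 hα1 (by positivity) p f G
    (fun x y => by
      set u := (y : EuclideanSpace ℝ (Fin n)) - x with hu
      set q := u - J x (p y - p x) with hq
      have hpu : p y - p x = W.orthogonalProjectionOnto u := by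
        simp only [p]; rw [← map_sub]
      have e1 : f y - f x - G x (p y - p x) = Wᗮ.orthogonalProjectionOnto q := by
        rw [hq, map_sub Wᗮ.orthogonalProjectionOnto, hu, map_sub Wᗮ.orthogonalProjectionOnto]; rfl
      have e2 : W.starProjection q = 0 := by
        rw [hq, map_sub, hJs, hpu, Submodule.coe_orthogonalProjectionOnto_apply, sub_self]
      have e3 : (V x)ᗮ.starProjection q = (V x)ᗮ.starProjection u := by
        rw [hq, map_sub, starProjection_orthogonal_eq_zero (hJV x _), sub_zero]
      rw [e1]
      calc _ ≤ ‖q‖ := Wᗮ.norm_orthogonalProjectionOnto_apply_le q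
        _ ≤ 2 * ‖(V x)ᗮ.starProjection q‖ :=
          norm_le_two_mul_of_starProjection_eq_zero (hdist' x x.2 x₀ hx₀) e2
        _ ≤ 2 * (D * ‖u‖ ^ (1 + α)) := by rw [e3]; gcongr; exact htan x x.2 y y.2
        _ ≤ 2 * (D * (4 * ‖p y - p x‖ ^ (1 + α))) := by
          gcongr
          refine le_trans ?_ (two_mul_rpow_one_add_le hα1 (norm_nonneg _))
          gcongr
          exact hbase x y
        _ = _ := by ring)
    (fun x y => by
      refine ContinuousLinearMap.opNorm_le_bound _ (by positivity) fun w => ?_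
      set q := J y w - J x w with hq
      have e1 : (G y - G x) w = Wᗮ.orthogonalProjectionOnto q := by
        rw [hq, map_sub]; rfl
      have e2 : W.starProjection q = 0 := by
        rw [hq, map_sub, hJs, hJs, sub_self]
      have e3 : (V x)ᗮ.starProjection q = -((V x).starProjection (J y w)
          - (V y).starProjection (J y w)) := by
        rw [hq, map_sub, starProjection_orthogonal_eq_zero (hJV x _),
          Submodule.starProjection_orthogonal_apply_eq_sub,
          Submodule.starProjection_eq_self_iff.2 (hJV y w)]
        abel
      rw [e1]
      calc _ ≤ ‖q‖ := Wᗮ.norm_orthogonalProjectionOnto_apply_le q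
        _ ≤ 2 * ‖(V x)ᗮ.starProjection q‖ :=
          norm_le_two_mul_of_starProjection_eq_zero (hdist' x x.2 x₀ hx₀) e2
        _ ≤ 2 * ((D * ‖(y : EuclideanSpace ℝ (Fin n)) - x‖ ^ α) * (2 * ‖w‖)) := by
          rw [e3, norm_neg]
          gcongr
          refine (norm_starProjection_sub_le _ _ _).trans ?_
          gcongr
          · exact hdist x x.2 y y.2
          · exact hJn y w
        _ ≤ 2 * ((D * (2 * ‖p y - p x‖ ^ α)) * (2 * ‖w‖)) := by
          gcongr
          calc _ ≤ (2 * ‖p y - p x‖) ^ α := by gcongr; exact hbase x y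
            _ = 2 ^ α * ‖p y - p x‖ ^ α := Real.mul_rpow (by norm_num) (norm_nonneg _)
            _ ≤ _ := by gcongr
        _ = _ := by ring)
  refine ⟨_, ⟨W, hV x₀ hx₀, Φ, hΦC, rfl⟩, fun x hx => ⟨p ⟨x, hx⟩, ?_⟩⟩
  dsimp only
  rw [hΦ]
  exact W.starProjection_add_starProjection_orthogonal x

/-- Serves the case of empty `F'`, where no point provides a base plane. -/
theorem exists_isC1AlphaGraph {k : ℕ} (hkn : k ≤ n) (α : ℝ) :
    ∃ Γ : Set (EuclideanSpace ℝ (Fin n)), IsC1AlphaGraph k α Γ := by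
  obtain ⟨v, hv⟩ := exists_linearIndependent_of_le_finrank (R := ℝ)
    (M := EuclideanSpace ℝ (Fin n)) (n := k) (by rwa [finrank_euclideanSpace_fin])
  refine ⟨_, Submodule.span ℝ (Set.range v), by simpa using finrank_span_eq_card hv,
    fun _ => 0, ⟨contDiff_const, 0, fun u w => ?_⟩, rfl⟩
  rw [fderiv_const_apply, fderiv_const_apply, sub_self, zero_mul]
  exact le_of_eq (ContinuousLinearMap.opNorm_zero (σ₁₂ := RingHom.id ℝ))

end Graph

/-- Uses `4 ^ (1 + α) ≥ 4`. Both smallness requirements follow: `C * r ^ α ≤ 1 / 8` and `(5 * lam +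
C) * r ^ α ≤ 1 / 4`. -/
theorem graphScale_spec {n : ℕ} (hn : 0 < n) {α δ M lam r : ℝ} (hα0 : 0 < α) (hδ : 0 < δ)
    (hM : 0 < M) (hlam : 0 < lam) (hr : 0 ≤ r) (hle : r ≤ graphScale n α δ M lam) :
    (24 * lam + 8 * tiltConst n δ M lam) * r ^ α ≤ 1 := by
  have hC := tiltConst_pos hn hδ hM hlam
  set B := 4 * lam * (2 + (4 : ℝ) ^ (1 + α)) + 8 * tiltConst n δ M lam with hB
  have h4 : (4 : ℝ) ≤ 4 ^ (1 + α) := by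
    simpa using Real.rpow_le_rpow_of_exponent_le (by norm_num : (1 : ℝ) ≤ 4)
      (by linarith : (1 : ℝ) ≤ 1 + α)
  have hB0 : 0 < B := by positivity
  have h1 : r ^ α ≤ B⁻¹ := by
    calc r ^ α ≤ (B ^ (-1 / α)) ^ α := by gcongr; exact hle
      _ = B⁻¹ := by
        rw [← Real.rpow_mul hB0.le, div_mul_cancel₀ _ hα0.ne', Real.rpow_neg_one]
  calc _ ≤ B * B⁻¹ := by gcongr; rw [hB]; nlinarith
    _ = 1 := mul_inv_cancel₀ hB0.ne'

end

/-! ### The main theorem. -/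

theorem proposition3p1 (n k : ℕ) (hk : 1 ≤ k) (hkn : k < n)
    (α : ℝ) (hα0 : 0 < α) (hα1 : α ≤ 1)
    (r₀ lam δ M ε : ℝ) (hr₀ : 0 < r₀) (hlam : 0 < lam) (hδ : 0 < δ) (hM : 0 < M)
    (hε : ε < 1 / (4 ^ k + 1) * δ)
    (F F' : Set (EuclideanSpace ℝ (Fin n))) (hF : F' ⊆ F)
    (hupper : ∀ x ∈ F, ∀ r : ℝ, 0 < r → r ≤ r₀ →
      MeasureTheory.Measure.hausdorffMeasure (k : ℝ) (F ∩ Metric.closedBall x r)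
        ≤ ENNReal.ofReal (M * r ^ k))
    (hlower : ∀ x ∈ F', ∀ r : ℝ, 0 < r → r ≤ r₀ →
      ENNReal.ofReal (δ * r ^ k)
        ≤ MeasureTheory.Measure.hausdorffMeasure (k : ℝ) (F ∩ Metric.closedBall x r))
    (V : EuclideanSpace ℝ (Fin n) → Submodule ℝ (EuclideanSpace ℝ (Fin n)))
    (hV : ∀ x ∈ F', Module.finrank ℝ (V x) = k)
    (hparab : ∀ x ∈ F', ∀ r : ℝ, 0 < r → r ≤ r₀ →
      MeasureTheory.Measure.hausdorffMeasure (k : ℝ)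
          ((F ∩ Metric.closedBall x r) \ paraboloid α x (V x) lam)
        ≤ ENNReal.ofReal (ε * r ^ k))
    (hdiam₁ : Metric.ediam F' ≤ ENNReal.ofReal (graphScale n α δ M lam))
    (hdiam₀ : Metric.ediam F' ≤ ENNReal.ofReal (r₀ / 5)) :
    (∀ x ∈ F', ∀ y ∈ F',
      planeDist (V x) (V y) ≤ tiltConst n δ M lam * ‖x - y‖ ^ α) ∧
    ∃ Γ : Set (EuclideanSpace ℝ (Fin n)), IsC1AlphaGraph k α Γ ∧ F' ⊆ Γ := by
  have hn : 0 < n := by omega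
  rcases F'.eq_empty_or_nonempty with rfl | hne
  · obtain ⟨Γ, hΓ⟩ := exists_isC1AlphaGraph hkn.le α
    exact ⟨by simp, Γ, hΓ, Set.empty_subset _⟩
  have hδM : δ ≤ M := by
    obtain ⟨x, hx⟩ := hne
    have h1 := (hlower x hx r₀ hr₀ le_rfl).trans (hupper x (hF hx) r₀ hr₀ le_rfl)
    rw [ENNReal.ofReal_le_ofReal_iff (by positivity)] at h1
    exact le_of_mul_le_mul_right h1 (by positivity)
  set C := tiltConst n δ M lam with hCdef
  have hC : 0 < C := tiltConst_pos hn hδ hM hlam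
  obtain ⟨m, rfl⟩ : ∃ m, k = m + 1 := ⟨k - 1, by omega⟩
  have hgs : 0 ≤ graphScale n α δ M lam := by
    unfold graphScale
    have := hC
    rw [hCdef] at this
    positivity
  have hd1 : ∀ x ∈ F', ∀ y ∈ F', ‖x - y‖ ≤ graphScale n α δ M lam := by
    intro x hx y hy
    have := (Metric.edist_le_ediam_of_mem hx hy).trans hdiam₁
    rwa [edist_dist, dist_eq_norm, ENNReal.ofReal_le_ofReal_iff hgs] at this
  have hd0 : ∀ x ∈ F', ∀ y ∈ F', ‖x - y‖ ≤ r₀ / 5 := by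
    intro x hx y hy
    have := (Metric.edist_le_ediam_of_mem hx hy).trans hdiam₀
    rwa [edist_dist, dist_eq_norm, ENNReal.ofReal_le_ofReal_iff (by positivity)] at this
  have hoverlap : ∀ x ∈ F', ∀ y ∈ F', x ≠ y →
      ENNReal.ofReal (2 / 5 * δ * ‖x - y‖ ^ (m + 1)) ≤
      MeasureTheory.Measure.hausdorffMeasure ((m + 1 : ℕ) : ℝ)
        (F ∩ Metric.closedBall x ‖x - y‖ ∩
          (paraboloid α x (V x) lam ∩ paraboloid α y (V y) lam)) :=
    fun x hx y hy hxy => le_measure_inter_paraboloid hk _ hδ hε (hlower x hx) (hparab x hx)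
      (hparab y hy) (norm_pos_iff.2 (sub_ne_zero.2 hxy)) (by linarith [hd0 x hx y hy]) le_rfl
  have htilt : ∀ x ∈ F', ∀ y ∈ F', planeDist (V x) (V y) ≤ C * ‖x - y‖ ^ α := by
    intro x hx y hy
    rcases eq_or_ne x y with rfl | hxy
    · simp [planeDist, Real.zero_rpow hα0.ne']
    have hr : 0 < ‖x - y‖ := norm_pos_iff.2 (sub_ne_zero.2 hxy)
    have hrr : ‖x - y‖ ≤ r₀ := by linarith [hd0 x hx y hy]
    have h1 := norm_starProjection_comp_le (m := m) (by omega) _ hα0 hα1 hlam hδ hδM hupper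
      (hV x hx) hr hrr le_rfl (hoverlap x hx y hy hxy)
    have h2 := norm_starProjection_comp_le (m := m) (by omega) _ hα0 hα1 hlam hδ hδM hupper
      (hV y hy) (norm_sub_rev x y ▸ hr) (norm_sub_rev x y ▸ hrr) le_rfl
      (hoverlap y hy x hx hxy.symm)
    rw [norm_sub_rev y x] at h2
    linarith [planeDist_le_add (V x) (V y)]
  -- The point `y` itself may lie outside the paraboloid at `x`, so the estimate passes through a
  -- point `z` of both. The paraboloid at `x` gives `4 * lam`, the one at `y` gives `lam`, and
  -- replacing `V y` by `V x` costs `C`.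
  have htan : ∀ x ∈ F', ∀ y ∈ F',
      ‖(V x)ᗮ.starProjection (y - x)‖ ≤ (5 * lam + C) * ‖y - x‖ ^ (1 + α) := by
    intro x hx y hy
    rcases eq_or_ne x y with rfl | hxy
    · simp [Real.zero_rpow (by linarith : 1 + α ≠ 0)]
    have hr : 0 < ‖y - x‖ := norm_pos_iff.2 (sub_ne_zero.2 hxy.symm)
    set r := ‖y - x‖ with hrdef
    obtain ⟨z, hz⟩ : (F ∩ Metric.closedBall y r ∩
        (paraboloid α y (V y) lam ∩ paraboloid α x (V x) lam)).Nonempty := by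
      refine MeasureTheory.nonempty_of_measure_ne_zero
        (ne_of_gt (lt_of_lt_of_le ?_ (hoverlap y hy x hx hxy.symm)))
      exact ENNReal.ofReal_pos.2 (by positivity)
    have hzy : ‖z - y‖ ≤ r := mem_closedBall_iff_norm.1 hz.1.2
    have hzx : ‖z - x‖ ≤ 2 * r := by
      rw [show z - x = (z - y) + (y - x) by abel]
      exact (norm_add_le _ _).trans (by linarith)
    have a1 := norm_le_of_mem_paraboloid hα0.le hlam.le hz.2.1 hzy
    have a2 : ‖(V x)ᗮ.starProjection (z - x)‖ ≤ lam * (4 * r ^ (1 + α)) :=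
      (norm_le_of_mem_paraboloid hα0.le hlam.le hz.2.2 hzx).trans
        (by gcongr; exact two_mul_rpow_one_add_le hα1 hr.le)
    have a3 : ‖(V y).starProjection (z - y) - (V x).starProjection (z - y)‖
        ≤ C * r ^ (1 + α) := by
      rw [Real.rpow_add hr, Real.rpow_one, mul_comm r, ← mul_assoc]
      exact (norm_starProjection_sub_le _ _ _).trans
        (mul_le_mul (htilt y hy x hx) hzy (norm_nonneg _) (by positivity))
    have e : (V x)ᗮ.starProjection (y - x) = (V x)ᗮ.starProjection (z - x)
        - ((V y)ᗮ.starProjection (z - y)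
          + ((V y).starProjection (z - y) - (V x).starProjection (z - y))) := by
      simp only [Submodule.starProjection_orthogonal_apply_eq_sub, map_sub]
      abel
    rw [e]
    refine (norm_sub_le _ _).trans ((add_le_add le_rfl (norm_add_le _ _)).trans ?_)
    linarith
  have hsmall : ∀ x ∈ F', ∀ y ∈ F', (24 * lam + 8 * C) * ‖y - x‖ ^ α ≤ 1 := fun x hx y hy =>
    graphScale_spec hn hα0 hδ hM hlam (norm_nonneg _) (hd1 y hy x hx)
  refine ⟨htilt, exists_isC1AlphaGraph_of_tangent (D := 5 * lam + C) hα0 hα1 (by positivity) hne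
    hV (fun x hx y hy => ?_) htan (fun x hx y hy => ?_) (fun x hx y hy => ?_)⟩
  · refine (htilt x hx y hy).trans ?_
    rw [norm_sub_rev]
    gcongr
    linarith
  · have h1 := htilt x hx y hy
    rw [norm_sub_rev] at h1
    nlinarith [hsmall x hx y hy, Real.rpow_nonneg (norm_nonneg (y - x)) α]
  · refine (htan x hx y hy).trans ?_
    rw [Real.rpow_add_of_nonneg (norm_nonneg _) zero_le_one hα0.le, Real.rpow_one,
      mul_comm ‖y - x‖, ← mul_assoc]
    gcongr
    have h0 := Real.rpow_nonneg (norm_nonneg (y - x)) α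
    nlinarith [hsmall x hx y hy, mul_nonneg hlam.le h0, mul_nonneg hC.le h0]
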